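/- Let $n\ge 1$ and let $\Omega\subset\mathbb R^n$ be a bounded domain (non-empty connected open set; no regularity of the boundary is assumed). Consider the buckling problem $$\Delta^2 v=-\Lambda\,\Delta v\ \text{ in }\Omega,\qquad v=\frac{\partial v}{\partial n}=0\ \text{ on }\partial\Omega,$$ in its weak form: a real number $\Lambda$ is an eigenvalue if there is $v\in H^2_0(\Omega)$, $v\neq 0$, real-valued, with $$\int_\Omega \Delta v\,\Delta w=\Lambda\int_\Omega\nabla v\cdot\nabla w\qquad\text{for all } w\in H^2_0(\Omega),$$ where $H^2_0(\Omega)$ is the closure of $C_c^\infty(\Omega)$ in the $H^2$ norm; the multiplicity of $\Lambda$ is the dimension of the space of such $v$ (together with $0$). Then all multiplicities are finite, the eigenvalues, each repeated according to its multiplicity, can be listed as $0<\Lambda_1\le\Lambda_2\le\Lambda_3\le\cdots\to\infty$, and $$\frac{\Lambda_2+\Lambda_3+\cdots+\Lambda_{n+1}}{\Lambda_1}\le n+4 .$$ -/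

import Mathlib

open MeasureTheory TopologicalSpace Filter
open scoped ContDiff Distributions LineDeriv

noncomputable section

namespace Buckling

/-- The real Hilbert space `L²(Ω)`, for an open set `Ω ⊆ ℝⁿ` with Lebesgue measure. -/
abbrev L2 {n : ℕ} (Ω : Opens (EuclideanSpace ℝ (Fin n))) : Type :=
  Lp ℝ 2 (volume.restrict (Ω : Set (EuclideanSpace ℝ (Fin n))))

/-- The `i`-th standard basis vector of `ℝⁿ`. -/
abbrev e {n : ℕ} (i : Fin n) : EuclideanSpace ℝ (Fin n) := EuclideanSpace.single i 1

theorem memLp_testFunction {n : ℕ} {Ω : Opens (EuclideanSpace ℝ (Fin n))} (φ : 𝓓(Ω, ℝ)) :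
    MemLp φ 2 (volume.restrict (Ω : Set (EuclideanSpace ℝ (Fin n)))) :=
  φ.continuous.memLp_of_hasCompactSupport φ.hasCompactSupport

/-- A test function `φ ∈ C_c^∞(Ω)`, seen as an element of `L²(Ω)`. -/
def toL2 {n : ℕ} (Ω : Opens (EuclideanSpace ℝ (Fin n))) : 𝓓(Ω, ℝ) →ₗ[ℝ] L2 Ω where
  toFun φ := (memLp_testFunction φ).toLp φ
  map_add' _ _ := rfl
  map_smul' _ _ := rfl

/-- Triples (function, first derivatives, second derivatives) of elements of `L²(Ω)`. The three
summands of the index type label the value, the `∂ᵢ` and the `∂ᵢ∂ⱼ`. The norm is the `H²` norm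
`(‖u‖² + ∑ᵢ ‖∂ᵢu‖² + ∑ᵢⱼ ‖∂ᵢ∂ⱼu‖²)^(1/2)`. -/
abbrev Jet {n : ℕ} (Ω : Opens (EuclideanSpace ℝ (Fin n))) : Type :=
  PiLp 2 (fun _ : Unit ⊕ Fin n ⊕ (Fin n × Fin n) => L2 Ω)

namespace Jet

variable {n : ℕ} {Ω : Opens (EuclideanSpace ℝ (Fin n))}

/-- The underlying `L²` function. -/
def val (u : Jet Ω) : L2 Ω := u (Sum.inl ())

/-- The `i`-th first derivative. -/
def d (u : Jet Ω) (i : Fin n) : L2 Ω := u (Sum.inr (Sum.inl i))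

/-- The second derivative `∂ᵢ∂ⱼ`. -/
def dd (u : Jet Ω) (i j : Fin n) : L2 Ω := u (Sum.inr (Sum.inr (i, j)))

/-- The Laplacian `∑ᵢ ∂ᵢ∂ᵢ u`. -/
def lap (u : Jet Ω) : L2 Ω := ∑ i, u.dd i i

end Jet

/-- The map `φ ↦ (φ, (∂ᵢφ)ᵢ, (∂ᵢ∂ⱼφ)ᵢⱼ)` on `C_c^∞(Ω)`. -/
def jet {n : ℕ} (Ω : Opens (EuclideanSpace ℝ (Fin n))) : 𝓓(Ω, ℝ) →ₗ[ℝ] Jet Ω where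
  toFun φ := WithLp.toLp 2
    (Sum.elim (fun _ => toL2 Ω φ)
      (Sum.elim (fun i => toL2 Ω (∂_{e i} φ)) (fun ij => toL2 Ω (∂_{e ij.1} (∂_{e ij.2} φ)))))
  map_add' φ ψ := by
    ext1 k
    rcases k with _ | _ | _ <;> simp [LineDeriv.lineDerivOp_add]
  map_smul' c φ := by
    ext1 k
    rcases k with _ | _ | _ <;> simp [LineDeriv.lineDerivOp_smul]

/-- The Sobolev space `H²₀(Ω)`: the closure of `C_c^∞(Ω)` in the `H²` norm. Each of its elements is
recorded together with its first and second weak derivatives, which the function determines. -/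
def H20 {n : ℕ} (Ω : Opens (EuclideanSpace ℝ (Fin n))) : Submodule ℝ (Jet Ω) :=
  (LinearMap.range (jet Ω)).topologicalClosure

/-- `∫_Ω Δu Δw`. -/
def lapForm {n : ℕ} {Ω : Opens (EuclideanSpace ℝ (Fin n))} (u w : Jet Ω) : ℝ :=
  ∫ x in (Ω : Set (EuclideanSpace ℝ (Fin n))), u.lap x * w.lap x

/-- `∫_Ω ∇u · ∇w`. -/
def gradForm {n : ℕ} {Ω : Opens (EuclideanSpace ℝ (Fin n))} (u w : Jet Ω) : ℝ :=
  ∫ x in (Ω : Set (EuclideanSpace ℝ (Fin n))), ∑ i, u.d i x * w.d i x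

theorem lapForm_eq_inner {n : ℕ} {Ω : Opens (EuclideanSpace ℝ (Fin n))} (u w : Jet Ω) :
    lapForm u w = inner ℝ u.lap w.lap := by
  simp only [lapForm, L2.inner_def, RCLike.inner_apply, conj_trivial, mul_comm]

theorem gradForm_eq_inner {n : ℕ} {Ω : Opens (EuclideanSpace ℝ (Fin n))} (u w : Jet Ω) :
    gradForm u w = ∑ i, inner ℝ (u.d i) (w.d i) := by
  simp only [L2.inner_def]
  rw [gradForm, ← integral_finsetSum _ fun i _ => L2.integrable_inner (u.d i) (w.d i)]
  simp only [RCLike.inner_apply, conj_trivial, mul_comm]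

/-- The space of weak solutions `v` of `Δ²v = -ΛΔv` in `Ω`, `v = ∂v/∂n = 0` on `∂Ω`, that is, of the
`v ∈ H²₀(Ω)` with `∫_Ω Δv Δw = Λ ∫_Ω ∇v · ∇w` for all `w ∈ H²₀(Ω)`. -/
def eigenspace {n : ℕ} (Ω : Opens (EuclideanSpace ℝ (Fin n))) (Λ : ℝ) : Submodule ℝ (Jet Ω) where
  carrier := {v | v ∈ H20 Ω ∧ ∀ w ∈ H20 Ω, lapForm v w = Λ * gradForm v w}
  zero_mem' := by
    refine ⟨zero_mem _, fun w _ => ?_⟩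
    simp [lapForm_eq_inner, gradForm_eq_inner, Jet.lap, Jet.dd, Jet.d]
  add_mem' := by
    rintro u v ⟨hu, hu'⟩ ⟨hv, hv'⟩
    refine ⟨add_mem hu hv, fun w hw => ?_⟩
    have h1 := hu' w hw
    have h2 := hv' w hw
    simp only [lapForm_eq_inner, gradForm_eq_inner, Jet.lap, Jet.dd, Jet.d, PiLp.add_apply,
      Finset.sum_add_distrib, inner_add_left, mul_add] at h1 h2 ⊢
    rw [h1, h2]
  smul_mem' := by
    rintro c u ⟨hu, hu'⟩
    refine ⟨Submodule.smul_mem _ c hu, fun w hw => ?_⟩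
    have h1 := hu' w hw
    simp only [lapForm_eq_inner, gradForm_eq_inner, Jet.lap, Jet.dd, Jet.d, PiLp.smul_apply,
      ← Finset.smul_sum, real_inner_smul_left, ← Finset.mul_sum] at h1 ⊢
    rw [h1]
    ring

/-- `Λ 0 ≤ Λ 1 ≤ Λ 2 ≤ … → ∞` lists all eigenvalues of the buckling problem on `Ω`, each repeated
according to its (finite) multiplicity: every real number `μ` occurs exactly `dim (eigenspace Ω μ)`
times, so exactly the eigenvalues occur. The first eigenvalue is `Λ 0`. -/
structure IsSpectrum {n : ℕ} (Ω : Opens (EuclideanSpace ℝ (Fin n))) (Λ : ℕ → ℝ) : Prop where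
  monotone : Monotone Λ
  tendsto : Tendsto Λ atTop atTop
  finiteDimensional (μ : ℝ) : FiniteDimensional ℝ (eigenspace Ω μ)
  multiplicity (μ : ℝ) : {i : ℕ | Λ i = μ}.ncard = Module.finrank ℝ (eigenspace Ω μ)

end Buckling

end

/-! Write `u` for a first eigenfunction, `Λ` for its eigenvalue, `g = ‖∇u‖²`. The trial functions
are `φ = ⟪ξ, x⟫ u - a u` with `‖ξ‖ = 1`. Since `u` solves the weak equation, `‖Δφ‖² - Λ‖∇φ‖²`
reduces to the commutator terms `4‖∂_ξ u‖² + 2g - Λ‖u‖²` (`trial_identity`), at most `4‖∂_ξ u‖² + g`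
because `g ≤ Λ‖u‖²`. Testing `∇φ` against `∇∂_ξ u` and integrating by parts bounds `‖∇φ‖²` from
below (`trial_sq_le`). If the Rayleigh quotient of `φ` is at least `M`, the two combine to `(M - Λ)
g ≤ 4‖∇∂_ξ u‖²` (`gap_le`).

Gram–Schmidt supplies an orthonormal basis `ξ_k` whose `k`-th trial function is gradient-orthogonal
to the first `k + 1` eigenfunctions (counting `k` from zero), so `M = Λ (k + 1)` is allowed. Summed
over `k`, the right sides give `4‖D²u‖² = 4‖Δu‖² = 4Λg`, whence the bound `n + 4`.

The spectrum is that of a compact operator. On `Δ(H²₀)` with the `L²` inner product, the gradient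
form is represented by a compact, symmetric, positive `T`, and `μ` is a buckling eigenvalue exactly
when `μ⁻¹` is an eigenvalue of `T`. Compactness is Rellich's theorem, which needs no boundary
regularity since `H²₀` is a closure of test functions; every identity on `H²₀` is likewise proved
for test functions and extended by `H20_induction`. -/

namespace CompactSymmetric

/-! ### Enumeration with multiplicity. -/

/-- A multiplicity function with infinite support which is finite on every half-line `(-∞, t]`
is the multiplicity function of a monotone sequence tending to infinity. -/
theorem exists_monotone_enumeration (m : ℝ → ℕ) (hfin : ∀ t, {μ | μ ≤ t ∧ m μ ≠ 0}.Finite)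
    (hinf : {μ | m μ ≠ 0}.Infinite) :
    ∃ Λ : ℕ → ℝ, Monotone Λ ∧ Tendsto Λ atTop atTop ∧ ∀ μ, {i | Λ i = μ}.ncard = m μ := by
  classical
  -- Each value `μ` is replaced by `m μ` copies, ordered lexicographically. Initial segments are
  -- finite and there is no maximum, so the order is that of `ℕ`.
  let ι := Σₗ μ : {μ // m μ ≠ 0}, Fin (m μ)
  have hmono : ∀ i j : ι, i ≤ j → ((ofLex i).1 : ℝ) ≤ (ofLex j).1 := by
    intro i j hij
    rcases (Sigma.Lex.le_def).1 hij with h | ⟨h, _⟩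
    · exact le_of_lt h
    · exact le_of_eq (congrArg Subtype.val h)
  have hlow : ∀ t : ℝ, {i : ι | ((ofLex i).1 : ℝ) ≤ t}.Finite := by
    intro t
    have hf : Finite {μ : {μ // m μ ≠ 0} // (μ : ℝ) ≤ t} := by
      refine @Finite.of_injective _ {μ | μ ≤ t ∧ m μ ≠ 0} (hfin t).to_subtype
        (fun μ => ⟨μ.1.1, μ.2, μ.1.2⟩) ?_
      intro a b hab
      exact Subtype.ext (Subtype.ext (Subtype.mk.inj hab))
    refine Set.Finite.subset (Set.finite_range
      (fun p : Σ μ : {μ : {μ // m μ ≠ 0} // (μ : ℝ) ≤ t}, Fin (m μ.1) =>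
        (toLex ⟨p.1.1, p.2⟩ : ι))) ?_
    intro i hi
    exact ⟨⟨⟨(ofLex i).1, hi⟩, (ofLex i).2⟩, rfl⟩
  have hIic : ∀ i : ι, (Set.Iic i).Finite := fun i =>
    (hlow (ofLex i).1).subset fun j hj => hmono j i hj
  have hinfι : Infinite ι := by
    have := hinf.to_subtype
    refine Infinite.of_injective
      (fun μ : {μ | m μ ≠ 0} => (toLex ⟨μ, ⟨0, Nat.pos_of_ne_zero μ.2⟩⟩ : ι)) ?_
    intro a b hab
    exact (Sigma.mk.inj_iff.1 (toLex.injective hab)).1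
  let _ : LocallyFiniteOrder ι := LocallyFiniteOrder.ofFiniteIcc fun a b =>
    (hIic b).subset Set.Icc_subset_Iic_self
  obtain ⟨i₀⟩ : Nonempty ι := inferInstance
  obtain ⟨b, -, hb⟩ := Set.exists_min_image (Set.Iic i₀) id (hIic i₀) ⟨i₀, le_refl i₀⟩
  let _ : OrderBot ι :=
    { bot := b
      bot_le := fun a => by
        rcases le_total a i₀ with h | h
        · exact hb a h
        · exact (hb i₀ (le_refl i₀)).trans h }
  have : NoMaxOrder ι := ⟨fun a => by
    by_contra! h
    exact Set.infinite_univ ((hIic a).subset fun x _ => not_lt.1 (h x))⟩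
  let _ : SuccOrder ι := LinearLocallyFiniteOrder.succOrder ι
  let _ : PredOrder ι := LinearLocallyFiniteOrder.predOrder ι
  let e : ι ≃o ℕ := orderIsoNatOfLinearSuccPredArch
  refine ⟨fun k => ((ofLex (e.symm k)).1 : ℝ), fun i j hij => hmono _ _ (e.symm.monotone hij),
    ?_, ?_⟩
  · refine tendsto_atTop_atTop_of_monotone (fun i j hij => hmono _ _ (e.symm.monotone hij)) ?_
    intro t
    by_contra! h
    refine Set.infinite_univ ((hlow t).subset fun i _ => ?_)
    simpa using (h (e i)).le
  · intro μ
    by_cases hμ : m μ = 0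
    · rw [hμ]
      convert Set.ncard_empty ℕ
      refine Set.eq_empty_of_forall_notMem fun i hi => ?_
      have := (ofLex (e.symm i)).1.2
      change ((ofLex (e.symm i)).1 : ℝ) = μ at hi
      rw [hi] at this
      exact this hμ
    · have : {i : ℕ | ((ofLex (e.symm i)).1 : ℝ) = μ} =
          Set.range (fun a : Fin (m μ) => e (toLex ⟨⟨μ, hμ⟩, a⟩)) := by
        ext i
        constructor
        · intro hi
          obtain ⟨⟨⟨ν, hν⟩, a⟩, hx⟩ : ∃ x, e.symm i = toLex x := ⟨_, rfl⟩
          change ((ofLex (e.symm i)).1 : ℝ) = μ at hi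
          rw [hx] at hi
          change ν = μ at hi
          subst hi
          refine ⟨a, ?_⟩
          change e (toLex ⟨⟨ν, hν⟩, a⟩) = i
          rw [← hx, OrderIso.apply_symm_apply]
        · rintro ⟨a, rfl⟩
          simp
      rw [this, ← Set.image_univ, Set.ncard_image_of_injective, Set.ncard_univ, Nat.card_fin]
      intro a a' haa
      have := e.injective haa
      simpa using this

/-! ### Spectral theory of compact symmetric operators. -/

section Spectral

open Module.End

variable {E : Type*} [NormedAddCommGroup E] [InnerProductSpace ℝ E] {T : E →L[ℝ] E}

theorem inner_eq_zero_of_mem_eigenspace (hT : (T : E →ₗ[ℝ] E).IsSymmetric) {μ ν : ℝ} (h : μ ≠ ν)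
    {x y : E} (hx : x ∈ eigenspace (T : E →ₗ[ℝ] E) μ) (hy : y ∈ eigenspace (T : E →ₗ[ℝ] E) ν) :
    inner ℝ x y = 0 :=
  hT.orthogonalFamily_eigenspaces h ⟨x, hx⟩ ⟨y, hy⟩

/-- The eigenvalues of a compact symmetric operator accumulate only at zero. -/
theorem finite_setOf_hasEigenvalue (hc : IsCompactOperator T)
    (hT : (T : E →ₗ[ℝ] E).IsSymmetric) {ε : ℝ} (hε : 0 < ε) :
    {μ : ℝ | ε ≤ μ ∧ HasEigenvalue (T : E →ₗ[ℝ] E) μ}.Finite := by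
  by_contra hinf
  let f := Set.Infinite.natEmbedding _ hinf
  have hex : ∀ k, ∃ x : E, x ∈ eigenspace (T : E →ₗ[ℝ] E) (f k) ∧ ‖x‖ = 1 := by
    intro k
    obtain ⟨x, hx, hx0⟩ := (f k).2.2.exists_hasEigenvector
    exact ⟨‖x‖⁻¹ • x, Submodule.smul_mem _ _ hx, by simp [norm_smul, hx0]⟩
  choose x hx hx1 using hex
  obtain ⟨K, hK, hTK⟩ := IsCompactOperator.image_closedBall_subset_compact
    (f := (T : E →ₗ[ℝ] E)) hc 1
  obtain ⟨a, -, φ, hφ, hlim⟩ := hK.tendsto_subseq (x := fun k => T (x k))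
    fun k => hTK ⟨x k, by simp [hx1], rfl⟩
  have hcau := hlim.cauchySeq
  rw [Metric.cauchySeq_iff] at hcau
  obtain ⟨N, hN⟩ := hcau ε hε
  have h := hN N le_rfl (N + 1) (Nat.le_succ N)
  have hne : (f (φ N) : ℝ) ≠ f (φ (N + 1)) := fun h' =>
    (hφ (Nat.lt_succ_self N)).ne (f.injective (Subtype.ext h'))
  have e1 : T (x (φ N)) = (f (φ N) : ℝ) • x (φ N) := mem_eigenspace_iff.1 (hx _)
  have e2 : T (x (φ (N + 1))) = (f (φ (N + 1)) : ℝ) • x (φ (N + 1)) := mem_eigenspace_iff.1 (hx _)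
  have h0 := inner_eq_zero_of_mem_eigenspace hT hne (hx (φ N)) (hx (φ (N + 1)))
  -- By orthogonality, images of unit eigenvectors for distinct eigenvalues at least `ε` stay more
  -- than `ε` apart, so no subsequence of them is Cauchy.
  have h3 : ‖T (x (φ N)) - T (x (φ (N + 1)))‖ ^ 2
      = (f (φ N) : ℝ) ^ 2 + (f (φ (N + 1)) : ℝ) ^ 2 := by
    rw [e1, e2, norm_sub_sq_real, real_inner_smul_left, real_inner_smul_right, h0, norm_smul,
      norm_smul, hx1, hx1]
    simp
  rw [Function.comp_apply, Function.comp_apply, dist_eq_norm] at h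
  have h4 := (f (φ N)).2.1
  have h5 := norm_nonneg (T (x (φ N)) - T (x (φ (N + 1))))
  nlinarith [sq_nonneg (f (φ (N + 1)) : ℝ)]

theorem finiteDimensional_eigenspace [CompleteSpace E] (hc : IsCompactOperator T)
    (hinj : Function.Injective T) (μ : ℝ) :
    FiniteDimensional ℝ (eigenspace (T : E →ₗ[ℝ] E) μ) := by
  by_cases hμ : μ = 0
  · rw [hμ, eigenspace_zero, LinearMap.ker_eq_bot.2 hinj]
    infer_instance
  · exact ContinuousLinearMap.finite_dimensional_eigenspace hc μ hμ

/-- Otherwise the spectral theorem would make `E` a finite sum of finite-dimensional eigenspaces. -/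
theorem infinite_setOf_hasEigenvalue [CompleteSpace E] (hc : IsCompactOperator T)
    (hT : (T : E →ₗ[ℝ] E).IsSymmetric) (hinj : Function.Injective T)
    (hE : ¬ FiniteDimensional ℝ E) :
    {μ : ℝ | HasEigenvalue (T : E →ₗ[ℝ] E) μ}.Infinite := by
  intro hfin
  apply hE
  have hfd : ∀ μ : ℝ, FiniteDimensional ℝ (eigenspace (T : E →ₗ[ℝ] E) μ) :=
    finiteDimensional_eigenspace hc hinj
  have hsup : (⨆ μ, eigenspace (T : E →ₗ[ℝ] E) μ)
      = ⨆ μ : hfin.toFinset, eigenspace (T : E →ₗ[ℝ] E) (μ : ℝ) := by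
    refine le_antisymm (iSup_le fun μ => ?_) (iSup_le fun μ => le_iSup _ (μ : ℝ))
    by_cases hμ : HasEigenvalue (T : E →ₗ[ℝ] E) μ
    · exact le_iSup (fun μ : hfin.toFinset => eigenspace (T : E →ₗ[ℝ] E) (μ : ℝ))
        ⟨μ, hfin.mem_toFinset.2 hμ⟩
    · rw [hasEigenvalue_iff, not_not] at hμ
      rw [hμ]
      exact bot_le
  have hfd' : FiniteDimensional ℝ ↥(⨆ μ, eigenspace (T : E →ₗ[ℝ] E) μ) := by
    rw [hsup]
    infer_instance
  have htop := Submodule.orthogonal_eq_bot_iff.1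
    (ContinuousLinearMap.orthogonalComplement_iSup_eigenspaces_eq_bot hc hT)
  rw [htop] at hfd'
  exact Module.Finite.equiv (Submodule.topEquiv (R := ℝ) (M := E))

/-- An enumeration of the inverse eigenvalues of a compact injective symmetric operator, with
multiplicity, comes with a Hilbert basis of eigenvectors. -/
theorem exists_hilbertBasis_eigenvectors [CompleteSpace E] (hc : IsCompactOperator T)
    (hT : (T : E →ₗ[ℝ] E).IsSymmetric) (hinj : Function.Injective T) {Λ : ℕ → ℝ}
    (hΛ : Tendsto Λ atTop atTop)
    (hm : ∀ μ, {i | Λ i = μ}.ncard = Module.finrank ℝ (eigenspace (T : E →ₗ[ℝ] E) μ⁻¹)) :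
    ∃ b : HilbertBasis ℕ ℝ E, ∀ i, T (b i) = (Λ i)⁻¹ • b i := by
  have hfd : ∀ μ : ℝ, FiniteDimensional ℝ (eigenspace (T : E →ₗ[ℝ] E) μ⁻¹) := fun μ =>
    finiteDimensional_eigenspace hc hinj μ⁻¹
  -- `ncard` is also zero on infinite sets; finiteness turns `hm` into a genuine count.
  have hfin : ∀ μ, {i | Λ i = μ}.Finite := by
    intro μ
    obtain ⟨N, hN⟩ := eventually_atTop.1 (hΛ.eventually_gt_atTop μ)
    refine (Set.finite_Iio N).subset fun i hi => ?_
    by_contra h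
    exact (hN i (not_lt.1 h)).ne' hi
  have eqv : ∀ μ, Nonempty ({i | Λ i = μ} ≃
      Fin (Module.finrank ℝ (eigenspace (T : E →ₗ[ℝ] E) μ⁻¹))) := by
    intro μ
    have := (hfin μ).to_subtype
    exact ⟨Finite.equivFinOfCardEq (hm μ)⟩
  let σ := fun μ => (eqv μ).some
  let B := fun μ : ℝ => stdOrthonormalBasis ℝ (eigenspace (T : E →ₗ[ℝ] E) μ⁻¹)
  let v : ℕ → E := fun i => B (Λ i) (σ (Λ i) ⟨i, rfl⟩)
  have hv : ∀ μ i (h : Λ i = μ), v i = B μ (σ μ ⟨i, h⟩) := by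
    rintro _ i rfl
    rfl
  have hmem : ∀ i, v i ∈ eigenspace (T : E →ₗ[ℝ] E) (Λ i)⁻¹ := fun i => (B _ _).2
  have hon : Orthonormal ℝ v := by
    rw [orthonormal_iff_ite]
    intro i j
    by_cases hij : Λ i = Λ j
    · rw [hv _ i hij, hv _ j rfl, ← Submodule.coe_inner,
        orthonormal_iff_ite.1 (B (Λ j)).orthonormal]
      simp
    · rw [if_neg (fun h => hij (congrArg Λ h))]
      exact inner_eq_zero_of_mem_eigenspace hT (fun h => hij (inv_injective h)) (hmem i) (hmem j)
  have hspan : (Submodule.span ℝ (Set.range v))ᗮ = ⊥ := by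
    rw [← le_bot_iff, ← ContinuousLinearMap.orthogonalComplement_iSup_eigenspaces_eq_bot hc hT]
    refine Submodule.orthogonal_le (iSup_le fun μ => ?_)
    obtain ⟨ν, rfl⟩ : ∃ ν : ℝ, μ = ν⁻¹ := ⟨μ⁻¹, by simp⟩
    intro x hx
    have hx' := (B ν).sum_repr ⟨x, hx⟩
    have hx2 := congrArg (Submodule.subtype _) hx'
    rw [map_sum] at hx2
    simp only [Submodule.subtype_apply, Submodule.coe_smul] at hx2
    rw [← hx2]
    refine Submodule.sum_mem _ fun a _ => Submodule.smul_mem _ _ (Submodule.subset_span ?_)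
    refine ⟨(σ ν).symm a, ?_⟩
    rw [hv ν _ ((σ ν).symm a).2]
    simp
  refine ⟨HilbertBasis.mkOfOrthogonalEqBot hon hspan, fun i => ?_⟩
  rw [HilbertBasis.coe_mkOfOrthogonalEqBot]
  exact mem_eigenspace_iff.1 (hmem i)

/-- Vectors orthogonal to the first `k` eigenvectors have Rayleigh quotient at most the `k`-th
eigenvalue. -/
theorem inner_apply_self_le [CompleteSpace E] (hT : (T : E →ₗ[ℝ] E).IsSymmetric) {Λ : ℕ → ℝ}
    (hmono : Monotone Λ) (b : HilbertBasis ℕ ℝ E) (hb : ∀ i, T (b i) = (Λ i)⁻¹ • b i) {k : ℕ}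
    (hk : 0 < Λ k) {u : E} (hu : ∀ j < k, inner ℝ (b j) u = 0) :
    Λ k * inner ℝ (T u) u ≤ inner ℝ u u := by
  -- Both sides are expanded in the basis: terms with `i < k` vanish, the others differ by the
  -- factor `Λ k / Λ i ≤ 1`.
  have h1 := (b.hasSum_inner_mul_inner (T u) u).mul_left (Λ k)
  refine hasSum_le (fun i => ?_) h1 (b.hasSum_inner_mul_inner u u)
  have h2 : inner ℝ (T u) (b i) = (Λ i)⁻¹ * inner ℝ u (b i) := by
    rw [← real_inner_smul_right, ← hb i]
    exact hT u (b i)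
  rcases lt_or_ge i k with hi | hi
  · simp [hu i hi]
  · rw [h2, real_inner_comm u (b i)]
    have h3 : Λ k * (Λ i)⁻¹ ≤ 1 := by
      rw [← div_eq_mul_inv]
      exact (div_le_one (hk.trans_le (hmono hi))).2 (hmono hi)
    nlinarith [mul_self_nonneg (inner ℝ (b i) u)]

end Spectral
end CompactSymmetric

namespace Buckling

/-! ### Test functions, integration by parts and multiplication by linear functions. -/

section TestFunctions

variable {n : ℕ} {Ω : Opens (EuclideanSpace ℝ (Fin n))}

theorem lineDerivOp_apply (v : EuclideanSpace ℝ (Fin n)) (φ : 𝓓(Ω, ℝ))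
    (x : EuclideanSpace ℝ (Fin n)) : (∂_{v} φ) x = fderiv ℝ φ x v := by
  rw [TestFunction.lineDerivOp_eq_lineDerivCLM ℝ, TestFunction.lineDerivCLM_apply]
  simp only [top_add, le_refl, if_true]
  exact (φ.contDiff.differentiable (by simp)).differentiableAt.lineDeriv_eq_fderiv

theorem lineDerivOp_comm (v w : EuclideanSpace ℝ (Fin n)) (φ : 𝓓(Ω, ℝ)) :
    ∂_{v} (∂_{w} φ) = ∂_{w} (∂_{v} φ) := by
  ext x
  have key : ∀ v w, (∂_{v} (∂_{w} φ)) x = fderiv ℝ (fderiv ℝ φ) x v w := by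
    intro v w
    rw [lineDerivOp_apply]
    have h : ⇑(∂_{w} φ : 𝓓(Ω, ℝ)) = fun y => fderiv ℝ φ y w :=
      funext fun y => lineDerivOp_apply w φ y
    have hd : DifferentiableAt ℝ (fderiv ℝ φ) x :=
      ((φ.contDiff.fderiv_right (m := ∞) le_rfl).differentiable (by simp)).differentiableAt
    rw [h, fderiv_clm_apply hd (differentiableAt_const w)]
    simp
  rw [key, key]
  exact (φ.contDiff.contDiffAt.isSymmSndFDerivAt
    (by
      rw [minSmoothness_of_isRCLikeNormedField]
      exact WithTop.coe_le_coe.2 (le_top : (2 : ℕ∞) ≤ ⊤))).eq v w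

theorem toL2_coe (φ : 𝓓(Ω, ℝ)) :
    toL2 Ω φ =ᵐ[volume.restrict (Ω : Set (EuclideanSpace ℝ (Fin n)))] φ :=
  (memLp_testFunction φ).coeFn_toLp

theorem apply_eq_zero_of_notMem (φ : 𝓓(Ω, ℝ)) {x : EuclideanSpace ℝ (Fin n)} (hx : x ∉ Ω) :
    φ x = 0 :=
  image_eq_zero_of_notMem_tsupport fun h => hx (φ.tsupport_subset h)

theorem inner_toL2 (φ ψ : 𝓓(Ω, ℝ)) : inner ℝ (toL2 Ω φ) (toL2 Ω ψ) = ∫ x, φ x * ψ x := by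
  rw [L2.inner_def, ← setIntegral_eq_integral_of_forall_compl_eq_zero
    (s := (Ω : Set (EuclideanSpace ℝ (Fin n))))
    (f := fun x => φ x * ψ x)
    (fun x hx => by rw [apply_eq_zero_of_notMem φ hx, zero_mul])]
  refine integral_congr_ae ?_
  filter_upwards [toL2_coe φ, toL2_coe ψ] with x h1 h2
  simp [h1, h2, mul_comm]

theorem integrable_mul (φ ψ : 𝓓(Ω, ℝ)) : Integrable fun x => φ x * ψ x :=
  (φ.continuous.mul ψ.continuous).integrable_of_hasCompactSupport φ.hasCompactSupport.mul_right

/-- Integration by parts. -/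
theorem inner_toL2_lineDerivOp (v : EuclideanSpace ℝ (Fin n)) (φ ψ : 𝓓(Ω, ℝ)) :
    inner ℝ (toL2 Ω φ) (toL2 Ω (∂_{v} ψ)) = -inner ℝ (toL2 Ω (∂_{v} φ)) (toL2 Ω ψ) := by
  rw [inner_toL2, inner_toL2]
  have h := integral_mul_fderiv_eq_neg_fderiv_mul_of_integrable (μ := volume)
    (f := φ) (g := ψ) (v := v) (by simpa only [lineDerivOp_apply] using integrable_mul (∂_{v} φ) ψ)
    (by simpa only [lineDerivOp_apply] using integrable_mul φ (∂_{v} ψ)) (integrable_mul φ ψ)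
    (fun x _ => (φ.contDiff.differentiable (by simp)).differentiableAt)
    (fun x _ => (ψ.contDiff.differentiable (by simp)).differentiableAt)
  simpa only [lineDerivOp_apply] using h

/-- The product of a test function with the linear function `x ↦ ⟪ξ, x⟫`. -/
noncomputable def mulLin (ξ : EuclideanSpace ℝ (Fin n)) (φ : 𝓓(Ω, ℝ)) : 𝓓(Ω, ℝ) where
  toFun x := inner ℝ ξ x * φ x
  contDiff' := (innerSL ℝ ξ).contDiff.mul φ.contDiff
  hasCompactSupport' := φ.hasCompactSupport.mul_left
  tsupport_subset' := (tsupport_mul_subset_right).trans φ.tsupport_subset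

theorem mulLin_apply (ξ : EuclideanSpace ℝ (Fin n)) (φ : 𝓓(Ω, ℝ))
    (x : EuclideanSpace ℝ (Fin n)) : mulLin ξ φ x = inner ℝ ξ x * φ x := rfl

theorem lineDerivOp_mulLin (ξ v : EuclideanSpace ℝ (Fin n)) (φ : 𝓓(Ω, ℝ)) :
    ∂_{v} (mulLin ξ φ) = mulLin ξ (∂_{v} φ) + inner ℝ ξ v • φ := by
  ext x
  rw [lineDerivOp_apply]
  have h1 : HasFDerivAt (mulLin ξ φ) _ x :=
    ((innerSL ℝ ξ).hasFDerivAt (x := x)).mul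
      (φ.contDiff.differentiable (by simp)).differentiableAt.hasFDerivAt
  rw [h1.fderiv]
  simp [mulLin_apply, lineDerivOp_apply, mul_comm]

theorem memLp_inner (hb : Bornology.IsBounded (Ω : Set (EuclideanSpace ℝ (Fin n))))
    (ξ : EuclideanSpace ℝ (Fin n)) :
    MemLp (fun x => (inner ℝ ξ x : ℝ)) ⊤
      (volume.restrict (Ω : Set (EuclideanSpace ℝ (Fin n)))) := by
  obtain ⟨C, hC⟩ := hb.exists_norm_le
  refine memLp_top_of_bound (by fun_prop) (‖ξ‖ * C) ?_
  filter_upwards [ae_restrict_mem Ω.isOpen.measurableSet] with x hx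
  exact (norm_inner_le_norm ξ x).trans (by gcongr; exact hC x hx)

/-- Multiplication by the linear function `x ↦ ⟪ξ, x⟫` on `L²(Ω)`, for bounded `Ω`. -/
noncomputable def mulL (hb : Bornology.IsBounded (Ω : Set (EuclideanSpace ℝ (Fin n))))
    (ξ : EuclideanSpace ℝ (Fin n)) : L2 Ω →L[ℝ] L2 Ω :=
  (ContinuousLinearMap.mul ℝ ℝ).holderL (volume.restrict (Ω : Set (EuclideanSpace ℝ (Fin n))))
    ⊤ 2 2 ((memLp_inner hb ξ).toLp)

variable (hb : Bornology.IsBounded (Ω : Set (EuclideanSpace ℝ (Fin n))))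
  (ξ : EuclideanSpace ℝ (Fin n))

theorem mulL_coe (u : L2 Ω) :
    mulL hb ξ u =ᵐ[volume.restrict (Ω : Set (EuclideanSpace ℝ (Fin n)))]
      fun x => inner ℝ ξ x * u x := by
  have h := (ContinuousLinearMap.mul ℝ ℝ).coeFn_holder (r := 2) ((memLp_inner hb ξ).toLp) u
  filter_upwards [h, (memLp_inner hb ξ).coeFn_toLp] with x h1 h2
  rw [h2] at h1
  exact h1

theorem toL2_mulLin (φ : 𝓓(Ω, ℝ)) : toL2 Ω (mulLin ξ φ) = mulL hb ξ (toL2 Ω φ) := by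
  refine Lp.ext ?_
  filter_upwards [toL2_coe φ, toL2_coe (mulLin ξ φ), mulL_coe hb ξ (toL2 Ω φ)] with x h1 h2 h3
  rw [h2, h3, h1, mulLin_apply]

theorem inner_mulL_left (u w : L2 Ω) : inner ℝ (mulL hb ξ u) w = inner ℝ u (mulL hb ξ w) := by
  rw [L2.inner_def, L2.inner_def]
  refine integral_congr_ae ?_
  filter_upwards [mulL_coe hb ξ u, mulL_coe hb ξ w] with x h1 h2
  simp only [h1, h2, RCLike.inner_apply, conj_trivial]
  ring

/-- The integrand is `⟪ξ, x⟫ ∂_v(φ²) / 2`, and the weight has constant derivative `⟪ξ, v⟫`. Both the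
Poincaré inequality and the lower bound for trial functions rest on this. -/
theorem inner_mulL_lineDerivOp (v : EuclideanSpace ℝ (Fin n)) (φ : 𝓓(Ω, ℝ)) :
    inner ℝ (mulL hb ξ (toL2 Ω φ)) (toL2 Ω (∂_{v} φ)) =
      -(1 / 2) * (inner ℝ ξ v * ‖toL2 Ω φ‖ ^ 2) := by
  have h := inner_toL2_lineDerivOp v (mulLin ξ φ) φ
  rw [lineDerivOp_mulLin, map_add, map_smul, toL2_mulLin hb, toL2_mulLin hb, inner_add_left,
    real_inner_smul_left, inner_mulL_left hb ξ (toL2 Ω (∂_{v} φ)),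
    real_inner_comm (mulL hb ξ (toL2 Ω φ)) (toL2 Ω (∂_{v} φ)), real_inner_self_eq_norm_sq] at h
  linarith

/-- The Poincaré inequality. -/
theorem norm_toL2_le (i : Fin n) (φ : 𝓓(Ω, ℝ)) :
    ‖toL2 Ω φ‖ ≤ 2 * ‖mulL hb (e i)‖ * ‖toL2 Ω (∂_{e i} φ)‖ := by
  have h := inner_mulL_lineDerivOp hb (e i) (e i) φ
  have h1 : (inner ℝ (e i) (e i) : ℝ) = 1 := by simp
  rw [h1] at h
  have h2 := abs_real_inner_le_norm (mulL hb (e i) (toL2 Ω φ)) (toL2 Ω (∂_{e i} φ))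
  rw [h] at h2
  have h3 := (mulL hb (e i)).le_opNorm (toL2 Ω φ)
  have h4 := neg_le_of_abs_le h2
  rcases (norm_nonneg (toL2 Ω φ)).eq_or_lt with h0 | h0
  · rw [← h0]; positivity
  · have h5 := mul_le_mul_of_nonneg_right h3 (norm_nonneg (toL2 Ω (∂_{e i} φ)))
    refine le_of_mul_le_mul_right ?_ h0
    nlinarith

end TestFunctions

/-! ### Identities and inequalities on `H²₀(Ω)`. -/

section Jets

variable {n : ℕ} {Ω : Opens (EuclideanSpace ℝ (Fin n))}

namespace Jet

@[fun_prop] theorem continuous_val : Continuous (val : Jet Ω → L2 Ω) :=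
  PiLp.continuous_apply 2 _ _

@[fun_prop] theorem continuous_d (i : Fin n) : Continuous fun u : Jet Ω => u.d i :=
  PiLp.continuous_apply 2 _ _

@[fun_prop] theorem continuous_dd (i j : Fin n) : Continuous fun u : Jet Ω => u.dd i j :=
  PiLp.continuous_apply 2 _ _

@[fun_prop] theorem continuous_lap : Continuous (lap : Jet Ω → L2 Ω) := by
  unfold lap
  fun_prop

theorem norm_sq_eq (u : Jet Ω) :
    ‖u‖ ^ 2 = ‖u.val‖ ^ 2 + (∑ i, ‖u.d i‖ ^ 2 + ∑ i, ∑ j, ‖u.dd i j‖ ^ 2) := by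
  rw [PiLp.norm_sq_eq_of_L2, Fintype.sum_sum_type, Fintype.sum_sum_type, Fintype.sum_prod_type]
  simp [val, d, dd]

theorem d_sub_smul (u w : Jet Ω) (a : ℝ) (i : Fin n) :
    (u - a • w).d i = u.d i - a • w.d i := rfl
theorem lap_sub_smul (u w : Jet Ω) (a : ℝ) : (u - a • w).lap = u.lap - a • w.lap := by
  simp [lap, dd, Finset.smul_sum, Finset.sum_sub_distrib]

/-- The directional derivative `∑ ξᵢ ∂ᵢu`. -/
noncomputable def dir (ξ : EuclideanSpace ℝ (Fin n)) (u : Jet Ω) : L2 Ω := ∑ i, ξ i • u.d i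

/-- The directional derivative `∑ ξᵢ ∂ᵢ∂ⱼu` of `∂ⱼu`. -/
noncomputable def ddir (ξ : EuclideanSpace ℝ (Fin n)) (u : Jet Ω) (j : Fin n) : L2 Ω :=
  ∑ i, ξ i • u.dd i j

end Jet

theorem jet_val (φ : 𝓓(Ω, ℝ)) : (jet Ω φ).val = toL2 Ω φ := rfl
theorem jet_d (φ : 𝓓(Ω, ℝ)) (i : Fin n) : (jet Ω φ).d i = toL2 Ω (∂_{e i} φ) := rfl
theorem jet_dd (φ : 𝓓(Ω, ℝ)) (i j : Fin n) :
    (jet Ω φ).dd i j = toL2 Ω (∂_{e i} (∂_{e j} φ)) := rfl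

/-- A closed property of jets of test functions extends to `H²₀(Ω)`. -/
theorem H20_induction {P : Jet Ω → Prop} (hP : IsClosed {u | P u}) (h : ∀ φ, P (jet Ω φ))
    {u : Jet Ω} (hu : u ∈ H20 Ω) : P u := by
  have h1 : ((LinearMap.range (jet Ω) : Submodule ℝ (Jet Ω)) : Set (Jet Ω)) ⊆ {u | P u} := by
    rintro _ ⟨φ, rfl⟩
    exact h φ
  exact closure_minimal h1 hP hu

theorem jet_mem_H20 (φ : 𝓓(Ω, ℝ)) : jet Ω φ ∈ H20 Ω :=
  Submodule.le_topologicalClosure _ ⟨φ, rfl⟩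

theorem inner_val_dd {u : Jet Ω} (hu : u ∈ H20 Ω) (i j : Fin n) :
    inner ℝ u.val (u.dd i j) = -inner ℝ (u.d i) (u.d j) := by
  refine H20_induction (P := fun u => inner ℝ u.val (u.dd i j) = -inner ℝ (u.d i) (u.d j))
    (isClosed_eq (by fun_prop) (by fun_prop)) (fun φ => ?_) hu
  exact inner_toL2_lineDerivOp (e i) φ _

theorem inner_d_dd_self {u : Jet Ω} (hu : u ∈ H20 Ω) (i j : Fin n) :
    inner ℝ (u.d j) (u.dd i j) = 0 := by
  refine H20_induction (P := fun u => inner ℝ (u.d j) (u.dd i j) = 0)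
    (isClosed_eq (by fun_prop) (by fun_prop)) (fun φ => ?_) hu
  have := inner_toL2_lineDerivOp (e i) (∂_{e j} φ) (∂_{e j} φ)
  rw [jet_d, jet_dd]
  rw [real_inner_comm] at this ⊢
  rw [real_inner_comm] at this
  linarith [real_inner_comm (toL2 Ω (∂_{e j} φ)) (toL2 Ω (∂_{e i} (∂_{e j} φ)))]

/-- Two integrations by parts turn `∫ (∂ᵢ∂ⱼφ)²` into `∫ ∂ᵢ∂ᵢφ ∂ⱼ∂ⱼφ`; there are no boundary terms.
-/
theorem sum_norm_dd_sq {u : Jet Ω} (hu : u ∈ H20 Ω) :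
    ∑ i, ∑ j, ‖u.dd i j‖ ^ 2 = ‖u.lap‖ ^ 2 := by
  refine H20_induction (P := fun u => ∑ i, ∑ j, ‖u.dd i j‖ ^ 2 = ‖u.lap‖ ^ 2)
    (isClosed_eq (by fun_prop) (by fun_prop)) (fun φ => ?_) hu
  rw [← real_inner_self_eq_norm_sq, Jet.lap, sum_inner]
  refine Finset.sum_congr rfl fun i _ => ?_
  rw [inner_sum]
  refine Finset.sum_congr rfl fun j _ => ?_
  rw [← real_inner_self_eq_norm_sq, jet_dd, jet_dd, jet_dd, inner_toL2_lineDerivOp,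
    lineDerivOp_comm (e i) (e j) φ, lineDerivOp_comm (e i) (e j) (∂_{e i} φ)]
  have := inner_toL2_lineDerivOp (e j) (∂_{e i} (∂_{e i} φ)) (∂_{e j} φ)
  rw [this]

variable (hb : Bornology.IsBounded (Ω : Set (EuclideanSpace ℝ (Fin n))))

theorem inner_mulL_d_dd (ξ : EuclideanSpace ℝ (Fin n)) {u : Jet Ω} (hu : u ∈ H20 Ω)
    (i j : Fin n) :
    inner ℝ (mulL hb ξ (u.d j)) (u.dd i j) = -(1 / 2) * (ξ i * ‖u.d j‖ ^ 2) := by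
  refine H20_induction
    (P := fun u => inner ℝ (mulL hb ξ (u.d j)) (u.dd i j) = -(1 / 2) * (ξ i * ‖u.d j‖ ^ 2))
    (isClosed_eq (by fun_prop) (by fun_prop)) (fun φ => ?_) hu
  have h := inner_mulL_lineDerivOp hb ξ (e i) (∂_{e j} φ)
  rw [EuclideanSpace.inner_single_right] at h
  simpa [jet_d, jet_dd] using h

include hb in
/-- The Poincaré inequality on `H²₀(Ω)`. -/
theorem exists_norm_sq_le (hn : 1 ≤ n) : ∃ C : ℝ, 0 < C ∧ ∀ u ∈ H20 Ω,
    ‖u‖ ^ 2 ≤ C * ‖u.lap‖ ^ 2 ∧ ‖u.val‖ ^ 2 ≤ C * ∑ i, ‖u.d i‖ ^ 2 := by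
  let i₀ : Fin n := ⟨0, hn⟩
  let K : ℝ := 2 * ‖mulL hb (e i₀)‖
  have hK : 0 ≤ K := by positivity
  -- The three summands bound the value (Poincaré twice), the gradient (once) and the Hessian, each
  -- against `‖Δu‖²`.
  refine ⟨K ^ 4 + K ^ 2 + 1, by positivity, fun u hu => ?_⟩
  have h1 : ‖u.val‖ ≤ K * ‖u.d i₀‖ :=
    H20_induction (P := fun u => ‖u.val‖ ≤ K * ‖u.d i₀‖)
      (isClosed_le (by fun_prop) (by fun_prop)) (fun φ => norm_toL2_le hb i₀ φ) hu
  have h2 : ∀ j, ‖u.d j‖ ≤ K * ‖u.dd i₀ j‖ := fun j =>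
    H20_induction (P := fun u => ‖u.d j‖ ≤ K * ‖u.dd i₀ j‖)
      (isClosed_le (by fun_prop) (by fun_prop)) (fun φ => norm_toL2_le hb i₀ _) hu
  have h3 : ‖u.val‖ ^ 2 ≤ K ^ 2 * ∑ i, ‖u.d i‖ ^ 2 := by
    calc ‖u.val‖ ^ 2 ≤ (K * ‖u.d i₀‖) ^ 2 := by gcongr
      _ = K ^ 2 * ‖u.d i₀‖ ^ 2 := mul_pow _ _ _
      _ ≤ _ := by
        gcongr
        exact Finset.single_le_sum (f := fun i => ‖u.d i‖ ^ 2) (fun i _ => sq_nonneg _)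
          (Finset.mem_univ i₀)
  have h4 : ∑ j, ‖u.d j‖ ^ 2 ≤ K ^ 2 * ‖u.lap‖ ^ 2 := by
    calc ∑ j, ‖u.d j‖ ^ 2 ≤ ∑ j, K ^ 2 * ‖u.dd i₀ j‖ ^ 2 := by
          refine Finset.sum_le_sum fun j _ => ?_
          rw [← mul_pow]
          gcongr
          exact h2 j
      _ = K ^ 2 * ∑ j, ‖u.dd i₀ j‖ ^ 2 := by rw [Finset.mul_sum]
      _ ≤ _ := by
        rw [← sum_norm_dd_sq hu]
        exact mul_le_mul_of_nonneg_left (Finset.single_le_sum (f := fun i => ∑ j, ‖u.dd i j‖ ^ 2)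
          (fun i _ => by positivity) (Finset.mem_univ i₀)) (sq_nonneg K)
  have h5 : 0 ≤ ∑ i, ‖u.d i‖ ^ 2 := by positivity
  constructor
  · rw [Jet.norm_sq_eq, sum_norm_dd_sq hu]
    nlinarith [mul_le_mul_of_nonneg_left h4 (sq_nonneg K)]
  · nlinarith [mul_nonneg (sq_nonneg (K ^ 2)) h5]

/-- By parts, `u.dd i j` is orthogonal to every test function; being itself an `L²` limit of test
functions, it is orthogonal to itself. -/
theorem dd_eq_zero_of_d_eq_zero {u : Jet Ω} (hu : u ∈ H20 Ω) (hd : ∀ i, u.d i = 0)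
    (i j : Fin n) : u.dd i j = 0 := by
  have h1 : ∀ ψ : 𝓓(Ω, ℝ), inner ℝ (toL2 Ω ψ) (u.dd i j) = 0 := by
    intro ψ
    have : inner ℝ (toL2 Ω ψ) (u.dd i j) = -inner ℝ (toL2 Ω (∂_{e i} ψ)) (u.d j) := by
      refine H20_induction
        (P := fun u => inner ℝ (toL2 Ω ψ) (u.dd i j) = -inner ℝ (toL2 Ω (∂_{e i} ψ)) (u.d j))
        (isClosed_eq (by fun_prop) (by fun_prop)) (fun φ => ?_) hu
      exact inner_toL2_lineDerivOp _ _ _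
    rw [this, hd, inner_zero_right, neg_zero]
  rw [← inner_self_eq_zero (𝕜 := ℝ)]
  exact H20_induction (P := fun w => inner ℝ (w.dd i j) (u.dd i j) = 0)
    (isClosed_eq (by fun_prop) (by fun_prop)) (fun φ => h1 _) hu

/-- Multiplication by the linear function `x ↦ ⟪ξ, x⟫`, on jets. -/
noncomputable def mulJet (ξ : EuclideanSpace ℝ (Fin n)) (u : Jet Ω) : Jet Ω :=
  WithLp.toLp 2 (Sum.elim (fun _ => mulL hb ξ u.val)
    (Sum.elim (fun i => mulL hb ξ (u.d i) + ξ i • u.val)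
      (fun ij => mulL hb ξ (u.dd ij.1 ij.2) + ξ ij.1 • u.d ij.2 + ξ ij.2 • u.d ij.1)))

theorem mulJet_val (ξ : EuclideanSpace ℝ (Fin n)) (u : Jet Ω) :
    (mulJet hb ξ u).val = mulL hb ξ u.val := rfl

theorem mulJet_d (ξ : EuclideanSpace ℝ (Fin n)) (u : Jet Ω) (i : Fin n) :
    (mulJet hb ξ u).d i = mulL hb ξ (u.d i) + ξ i • u.val := rfl

theorem mulJet_dd (ξ : EuclideanSpace ℝ (Fin n)) (u : Jet Ω) (i j : Fin n) :
    (mulJet hb ξ u).dd i j = mulL hb ξ (u.dd i j) + ξ i • u.d j + ξ j • u.d i := rfl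

theorem mulJet_lap (ξ : EuclideanSpace ℝ (Fin n)) (u : Jet Ω) :
    (mulJet hb ξ u).lap = mulL hb ξ u.lap + (2 : ℝ) • u.dir ξ := by
  simp only [Jet.lap, mulJet_dd, map_sum, Jet.dir, Finset.smul_sum, ← Finset.sum_add_distrib,
    two_smul, add_assoc]

theorem mulJet_dir (ξ : EuclideanSpace ℝ (Fin n)) (hξ : ‖ξ‖ = 1) (u : Jet Ω) :
    (mulJet hb ξ u).dir ξ = mulL hb ξ (u.dir ξ) + u.val := by
  have h : ∑ i, ξ i * ξ i = 1 := by
    have := EuclideanSpace.real_norm_sq_eq ξ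
    rw [hξ] at this
    simpa [sq] using this.symm
  simp only [Jet.dir, mulJet_d, map_sum, smul_add, Finset.sum_add_distrib, map_smul, smul_smul,
    ← Finset.sum_smul, h, one_smul]

theorem mulJet_jet (ξ : EuclideanSpace ℝ (Fin n)) (φ : 𝓓(Ω, ℝ)) :
    mulJet hb ξ (jet Ω φ) = jet Ω (mulLin ξ φ) := by
  have hξ : ∀ i, inner ℝ ξ (e i) = ξ i := fun i => by
    rw [EuclideanSpace.inner_single_right]; simp
  ext1 k
  rcases k with _ | i | ⟨i, j⟩
  · exact (toL2_mulLin hb ξ φ).symm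
  · change (mulJet hb ξ (jet Ω φ)).d i = (jet Ω (mulLin ξ φ)).d i
    rw [mulJet_d, jet_d, jet_d, jet_val, lineDerivOp_mulLin, map_add, map_smul,
      toL2_mulLin hb, hξ]
  · change (mulJet hb ξ (jet Ω φ)).dd i j = (jet Ω (mulLin ξ φ)).dd i j
    rw [mulJet_dd, jet_d, jet_d, jet_dd, jet_dd, lineDerivOp_mulLin, LineDeriv.lineDerivOp_add,
      LineDeriv.lineDerivOp_smul, lineDerivOp_mulLin, map_add, map_add, map_smul, map_smul,
      toL2_mulLin hb, hξ, hξ]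

@[fun_prop] theorem continuous_mulJet (ξ : EuclideanSpace ℝ (Fin n)) :
    Continuous (mulJet hb ξ) := by
  refine (PiLp.continuous_toLp 2 _).comp (continuous_pi fun k => ?_)
  rcases k with _ | i | ⟨i, j⟩ <;> simp only [Sum.elim_inl, Sum.elim_inr] <;> fun_prop

/-- Makes `⟪ξ, x⟫ u`, and by iteration `⟪ξ, x⟫² u`, admissible in the weak equation. -/
theorem mulJet_mem_H20 (ξ : EuclideanSpace ℝ (Fin n)) {u : Jet Ω} (hu : u ∈ H20 Ω) :
    mulJet hb ξ u ∈ H20 Ω := by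
  refine H20_induction (P := fun u => mulJet hb ξ u ∈ H20 Ω) ?_ (fun φ => ?_) hu
  · exact (Submodule.isClosed_topologicalClosure _).preimage (continuous_mulJet hb ξ)
  · rw [mulJet_jet]
    exact jet_mem_H20 _

end Jets

/-! ### Trial functions and the gap estimate. -/

section TrialFunctions

variable {n : ℕ} {Ω : Opens (EuclideanSpace ℝ (Fin n))}

theorem gradForm_self (u : Jet Ω) : gradForm u u = ∑ i, ‖u.d i‖ ^ 2 := by
  simp only [gradForm_eq_inner, real_inner_self_eq_norm_sq]

theorem lapForm_self (u : Jet Ω) : lapForm u u = ‖u.lap‖ ^ 2 := by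
  simp only [lapForm_eq_inner, real_inner_self_eq_norm_sq]

theorem gradForm_comm (u w : Jet Ω) : gradForm u w = gradForm w u := by
  simp only [gradForm_eq_inner, real_inner_comm]

theorem lapForm_comm (u w : Jet Ω) : lapForm u w = lapForm w u := by
  simp only [lapForm_eq_inner, real_inner_comm]

theorem gradForm_sub_smul (u w z : Jet Ω) (a : ℝ) :
    gradForm z (u - a • w) = gradForm z u - a * gradForm z w := by
  simp only [gradForm_eq_inner, Jet.d_sub_smul, inner_sub_right, real_inner_smul_right,
    Finset.sum_sub_distrib, Finset.mul_sum]

theorem lapForm_sub_smul (u w z : Jet Ω) (a : ℝ) :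
    lapForm z (u - a • w) = lapForm z u - a * lapForm z w := by
  simp only [lapForm_eq_inner, Jet.lap_sub_smul, inner_sub_right, real_inner_smul_right]

/-- Green's identity. -/
theorem inner_val_lap {u : Jet Ω} (hu : u ∈ H20 Ω) :
    inner ℝ u.val u.lap = -gradForm u u := by
  simp only [gradForm_eq_inner, Jet.lap, inner_sum, inner_val_dd hu, Finset.sum_neg_distrib]

/-- Cauchy–Schwarz in Green's identity. For an eigenfunction it yields `‖∇u‖² ≤ Λ‖u‖²`. -/
theorem gradForm_sq_le {u : Jet Ω} (hu : u ∈ H20 Ω) :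
    gradForm u u ^ 2 ≤ ‖u.val‖ ^ 2 * lapForm u u := by
  rw [lapForm_self, ← mul_pow, sq_le_sq, ← abs_neg, ← inner_val_lap hu,
    abs_of_nonneg (by positivity : 0 ≤ ‖u.val‖ * ‖u.lap‖)]
  exact abs_real_inner_le_norm _ _

variable (hb : Bornology.IsBounded (Ω : Set (EuclideanSpace ℝ (Fin n))))
  {ξ : EuclideanSpace ℝ (Fin n)}

/-- With `x_ξ = ⟪ξ, x⟫`, one has `Δ(x_ξ u) = x_ξ Δu + 2∂_ξ u` and `Δ(x_ξ² u) = x_ξ² Δu + 4x_ξ ∂_ξ u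
+ 2u`. Everything cancels except `4‖∂_ξ u‖² - 2⟪u, Δu⟫`. -/
theorem lapForm_mulJet (hξ : ‖ξ‖ = 1) {u : Jet Ω} (hu : u ∈ H20 Ω) :
    lapForm (mulJet hb ξ u) (mulJet hb ξ u) - lapForm u (mulJet hb ξ (mulJet hb ξ u)) =
      4 * ‖u.dir ξ‖ ^ 2 + 2 * gradForm u u := by
  have h := inner_val_lap hu
  rw [real_inner_comm] at h
  simp only [lapForm_eq_inner, mulJet_lap, mulJet_dir hb ξ hξ, map_add, map_smul,
    inner_add_left, inner_add_right, real_inner_smul_left, real_inner_smul_right, smul_add,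
    inner_mulL_left, ← real_inner_self_eq_norm_sq]
  rw [← inner_mulL_left hb ξ (u.dir ξ) u.lap, real_inner_comm u.lap (mulL hb ξ (u.dir ξ)), h]
  ring

theorem gradForm_mulJet (hξ : ‖ξ‖ = 1) (u : Jet Ω) :
    gradForm (mulJet hb ξ u) (mulJet hb ξ u) - gradForm u (mulJet hb ξ (mulJet hb ξ u)) =
      ‖u.val‖ ^ 2 := by
  have h : ∑ i, ξ i * ξ i = 1 := by
    have := EuclideanSpace.real_norm_sq_eq ξ
    rw [hξ] at this
    simpa [sq] using this.symm
  simp only [gradForm_eq_inner, ← Finset.sum_sub_distrib]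
  rw [← one_mul (‖u.val‖ ^ 2), ← h, Finset.sum_mul]
  refine Finset.sum_congr rfl fun i _ => ?_
  simp only [mulJet_d, mulJet_val, map_add, map_smul, inner_add_left, inner_add_right,
    real_inner_smul_left, real_inner_smul_right, inner_mulL_left, ← real_inner_self_eq_norm_sq]
  rw [← inner_mulL_left hb ξ u.val, real_inner_comm (u.d i) (mulL hb ξ u.val)]
  ring

/-- The form `lapForm - Λ gradForm` vanishes whenever one argument is `u`. So `a` drops out, and the
pairing of `u` with `⟪ξ, x⟫² u` may be subtracted freely, leaving the two commutator identities. -/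
theorem trial_identity (hξ : ‖ξ‖ = 1) {u : Jet Ω} (hu : u ∈ H20 Ω) {Λ : ℝ}
    (hΛ : ∀ w ∈ H20 Ω, lapForm u w = Λ * gradForm u w) (a : ℝ) :
    lapForm (mulJet hb ξ u - a • u) (mulJet hb ξ u - a • u) -
        Λ * gradForm (mulJet hb ξ u - a • u) (mulJet hb ξ u - a • u) =
      4 * ‖u.dir ξ‖ ^ 2 + 2 * gradForm u u - Λ * ‖u.val‖ ^ 2 := by
  have h1 := lapForm_mulJet hb hξ hu
  have h2 := gradForm_mulJet hb hξ u
  have hm := mulJet_mem_H20 hb ξ hu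
  have h3 := hΛ _ hm
  have h4 := hΛ _ (mulJet_mem_H20 hb ξ hm)
  have h5 := hΛ u hu
  rw [lapForm_sub_smul, gradForm_sub_smul, lapForm_comm _ u, gradForm_comm _ u,
    lapForm_comm _ (mulJet hb ξ u), gradForm_comm _ (mulJet hb ξ u), lapForm_sub_smul,
    gradForm_sub_smul, lapForm_sub_smul, gradForm_sub_smul, lapForm_comm _ u, gradForm_comm _ u]
  linear_combination h1 - Λ * h2 + h4 - 2 * a * h3 + a ^ 2 * h5

/-- Cauchy–Schwarz for `∇φ` against `∇∂_ξ u`. By parts, the weighted term gives `-g/2`, the term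
from differentiating the weight gives `-‖∂_ξ u‖²`, and the `a` term gives zero. -/
theorem trial_sq_le (hξ : ‖ξ‖ = 1) {u : Jet Ω} (hu : u ∈ H20 Ω) (a : ℝ) :
    (gradForm u u / 2 + ‖u.dir ξ‖ ^ 2) ^ 2 ≤
      gradForm (mulJet hb ξ u - a • u) (mulJet hb ξ u - a • u) * ∑ j, ‖u.ddir ξ j‖ ^ 2 := by
  have hn : ∑ i, ξ i * ξ i = 1 := by
    have := EuclideanSpace.real_norm_sq_eq ξ
    rw [hξ] at this
    simpa [sq] using this.symm
  have h1 : ∀ j, inner ℝ (mulL hb ξ (u.d j)) (u.ddir ξ j) = -(1 / 2) * ‖u.d j‖ ^ 2 := by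
    intro j
    simp only [Jet.ddir, inner_sum, real_inner_smul_right, inner_mulL_d_dd hb ξ hu]
    calc ∑ i, ξ i * (-(1 / 2) * (ξ i * ‖u.d j‖ ^ 2))
        = -(1 / 2) * ((∑ i, ξ i * ξ i) * ‖u.d j‖ ^ 2) := by
          rw [Finset.sum_mul, Finset.mul_sum]
          exact Finset.sum_congr rfl fun i _ => by ring
      _ = _ := by rw [hn, one_mul]
  have h2 : ∑ j, ξ j * inner ℝ u.val (u.ddir ξ j) = -‖u.dir ξ‖ ^ 2 := by
    rw [← real_inner_self_eq_norm_sq]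
    simp only [Jet.ddir, Jet.dir, inner_sum, sum_inner, real_inner_smul_right,
      real_inner_smul_left, inner_val_dd hu, ← Finset.sum_neg_distrib, Finset.mul_sum]
    refine Finset.sum_congr rfl fun i _ => Finset.sum_congr rfl fun j _ => ?_
    rw [real_inner_comm]
    ring
  have h3 : ∀ j, inner ℝ (u.d j) (u.ddir ξ j) = 0 := by
    intro j
    simp [Jet.ddir, inner_sum, real_inner_smul_right, inner_d_dd_self hu]
  have h4 : ∑ j, inner ℝ ((mulJet hb ξ u - a • u).d j) (u.ddir ξ j) =
      -(gradForm u u / 2 + ‖u.dir ξ‖ ^ 2) := by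
    simp only [Jet.d_sub_smul, mulJet_d, inner_sub_left, inner_add_left, real_inner_smul_left, h1,
      h3, mul_zero, sub_zero, Finset.sum_add_distrib, h2, ← Finset.mul_sum, gradForm_self]
    ring
  have h5 : |∑ j, inner ℝ ((mulJet hb ξ u - a • u).d j) (u.ddir ξ j)| ≤
      ∑ j, ‖(mulJet hb ξ u - a • u).d j‖ * ‖u.ddir ξ j‖ :=
    (Finset.abs_sum_le_sum_abs _ _).trans
      (Finset.sum_le_sum fun j _ => abs_real_inner_le_norm _ _)
  rw [h4, abs_neg] at h5
  rw [gradForm_self (mulJet hb ξ u - a • u), ← sq_abs]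
  exact (pow_le_pow_left₀ (abs_nonneg _) h5 2).trans (Finset.sum_mul_sq_le_sq_mul_sq _ _ _)

/-- The Hilbert–Schmidt norm of the Hessian does not depend on the orthonormal basis. -/
theorem sum_ddir_sq (ξ : OrthonormalBasis (Fin n) ℝ (EuclideanSpace ℝ (Fin n))) {u : Jet Ω}
    (hu : u ∈ H20 Ω) : ∑ k, ∑ j, ‖u.ddir (ξ k) j‖ ^ 2 = lapForm u u := by
  rw [lapForm_self, ← sum_norm_dd_sq hu, Finset.sum_comm]
  conv_rhs => rw [Finset.sum_comm]
  refine Finset.sum_congr rfl fun j _ => ?_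
  have h : ∀ i l : Fin n, ∑ k, (ξ k) i * (ξ k) l = if i = l then 1 else 0 := by
    intro i l
    have := ξ.sum_inner_mul_inner (e i) (e l)
    simpa [EuclideanSpace.inner_single_left, EuclideanSpace.inner_single_right,
      PiLp.single_apply, eq_comm] using this
  simp only [← real_inner_self_eq_norm_sq, Jet.ddir, inner_sum, sum_inner, real_inner_smul_left,
    real_inner_smul_right]
  rw [Finset.sum_comm]
  refine Finset.sum_congr rfl fun i _ => ?_
  rw [Finset.sum_comm]
  have : ∀ l, ∑ k, ξ k i * (ξ k l * inner ℝ (u.dd l j) (u.dd i j)) =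
      (if i = l then 1 else 0) * inner ℝ (u.dd l j) (u.dd i j) := by
    intro l
    rw [← h, Finset.sum_mul]
    exact Finset.sum_congr rfl fun k _ => by ring
  simp [this]

/-- Here `A = ‖Δφ‖²`, `b = ‖∇φ‖²`, `p = ‖∂_ξ u‖²`, `q = ‖∇∂_ξ u‖²`, `V = ‖u‖²`. -/
theorem gap_arith {M Λ b A g p q V : ℝ} (hp : 0 ≤ p) (hq : 0 ≤ q) (hg : 0 < g)
    (h1 : A - Λ * b = 4 * p + 2 * g - Λ * V) (h2 : (g / 2 + p) ^ 2 ≤ b * q)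
    (h3 : g ^ 2 ≤ V * (Λ * g)) (hM : M * b ≤ A) : (M - Λ) * g ≤ 4 * q := by
  have h4 : g ≤ Λ * V := by
    refine le_of_mul_le_mul_right ?_ hg
    linarith
  have h5 : (M - Λ) * b ≤ 4 * p + g := by linarith
  rcases le_or_gt M Λ with h | h
  · have : (M - Λ) * g ≤ 0 := mul_nonpos_of_nonpos_of_nonneg (by linarith) hg.le
    linarith
  · refine le_of_mul_le_mul_right ?_ (by positivity : 0 < (g / 2 + p) ^ 2)
    calc (M - Λ) * g * (g / 2 + p) ^ 2 ≤ (M - Λ) * g * (b * q) :=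
          mul_le_mul_of_nonneg_left h2 (mul_nonneg (by linarith) hg.le)
      _ = g * q * ((M - Λ) * b) := by ring
      _ ≤ g * q * (4 * p + g) := mul_le_mul_of_nonneg_left h5 (mul_nonneg hg.le hq)
      -- `g (4p + g) = 4 (g/2 + p)² - 4p²`.
      _ ≤ _ := by nlinarith [mul_nonneg hq (sq_nonneg p)]

/-- The gap estimate: a trial function `⟪ξ, x⟫ v - a v` whose Rayleigh quotient is at least `M`. -/
theorem gap_le (hξ : ‖ξ‖ = 1) {u : Jet Ω} (hu : u ∈ H20 Ω) {Λ M : ℝ}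
    (hΛ : ∀ w ∈ H20 Ω, lapForm u w = Λ * gradForm u w) (hpos : 0 < gradForm u u) (a : ℝ)
    (hM : M * gradForm (mulJet hb ξ u - a • u) (mulJet hb ξ u - a • u) ≤
      lapForm (mulJet hb ξ u - a • u) (mulJet hb ξ u - a • u)) :
    (M - Λ) * gradForm u u ≤ 4 * ∑ j, ‖u.ddir ξ j‖ ^ 2 := by
  have h3 := gradForm_sq_le hu
  rw [hΛ u hu] at h3
  exact gap_arith (by positivity) (by positivity) hpos (trial_identity hb hξ hu hΛ a)
    (trial_sq_le hb hξ hu a) h3 hM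

end TrialFunctions

/-! ### Translation estimates and cubes. -/

section Rellich

open scoped ENNReal

theorem eLpNorm_two_sq {α : Type*} [MeasurableSpace α] {μ : Measure α} (f : α → ℝ) :
    eLpNorm f 2 μ ^ 2 = ∫⁻ x, ‖f x‖ₑ ^ 2 ∂μ := by
  have h := eLpNorm_nnreal_pow_eq_lintegral (μ := μ) (f := f) (p := 2) two_ne_zero
  simpa using h

theorem enorm_integral_sq_le {α : Type*} [MeasurableSpace α] {μ : Measure α}
    [IsProbabilityMeasure μ] {f : α → ℝ} (hf : AEStronglyMeasurable f μ) :
    ‖∫ x, f x ∂μ‖ₑ ^ 2 ≤ ∫⁻ x, ‖f x‖ₑ ^ 2 ∂μ := by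
  rw [← eLpNorm_two_sq]
  gcongr
  refine (enorm_integral_le_lintegral_enorm f).trans ?_
  rw [← eLpNorm_one_eq_lintegral_enorm]
  exact eLpNorm_le_eLpNorm_of_exponent_le (by norm_num) hf

variable {n : ℕ} {Ω : Opens (EuclideanSpace ℝ (Fin n))}

theorem lintegral_enorm_sq (φ : 𝓓(Ω, ℝ)) :
    ∫⁻ x, ‖φ x‖ₑ ^ 2 = ENNReal.ofReal (‖toL2 Ω φ‖ ^ 2) := by
  rw [← real_inner_self_eq_norm_sq, inner_toL2,
    ofReal_integral_eq_lintegral_ofReal (integrable_mul φ φ)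
      (Eventually.of_forall fun x => mul_self_nonneg (φ x))]
  refine lintegral_congr fun x => ?_
  rw [← pow_two, ← sq_abs, ENNReal.ofReal_pow (abs_nonneg _), Real.enorm_eq_ofReal_abs]

theorem sub_eq_integral (φ : 𝓓(Ω, ℝ)) (x z : EuclideanSpace ℝ (Fin n)) :
    φ (x + z) - φ x = ∫ t in Set.Icc (0 : ℝ) 1, (∂_{z} φ) (x + t • z) := by
  have hd : ∀ t ∈ Set.uIcc (0 : ℝ) 1,
      HasDerivAt (fun t : ℝ => φ (x + t • z)) ((∂_{z} φ) (x + t • z)) t := by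
    intro t _
    rw [lineDerivOp_apply]
    have h1 : HasDerivAt (fun t : ℝ => x + t • z) z t := by
      simpa using ((hasDerivAt_id t).smul_const z).const_add x
    exact (φ.contDiff.differentiable (by simp)).differentiableAt.hasFDerivAt.comp_hasDerivAt t h1
  have hc : Continuous fun t : ℝ => (∂_{z} φ) (x + t • z) :=
    (∂_{z} φ).continuous.comp (by fun_prop)
  have h := intervalIntegral.integral_eq_sub_of_hasDerivAt hd (hc.intervalIntegrable 0 1)
  rw [integral_Icc_eq_integral_Ioc, ← intervalIntegral.integral_of_le zero_le_one, h]
  simp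

/-- The `L²` modulus of continuity is controlled by the gradient. -/
theorem lintegral_translate_sub_le (φ : 𝓓(Ω, ℝ)) (z : EuclideanSpace ℝ (Fin n)) :
    ∫⁻ x, ‖φ (x + z) - φ x‖ₑ ^ 2 ≤ ∫⁻ x, ‖(∂_{z} φ) x‖ₑ ^ 2 := by
  have : IsProbabilityMeasure (volume.restrict (Set.Icc (0 : ℝ) 1)) := ⟨by simp⟩
  have hc : Continuous fun p : EuclideanSpace ℝ (Fin n) × ℝ => (∂_{z} φ) (p.1 + p.2 • z) :=
    (∂_{z} φ).continuous.comp (by fun_prop)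
  -- Jensen along the segment from `x` to `x + z`, then Tonelli and translation invariance.
  calc ∫⁻ x, ‖φ (x + z) - φ x‖ₑ ^ 2
      ≤ ∫⁻ x, ∫⁻ t in Set.Icc (0 : ℝ) 1, ‖(∂_{z} φ) (x + t • z)‖ₑ ^ 2 := by
        refine lintegral_mono fun x => ?_
        rw [sub_eq_integral]
        exact enorm_integral_sq_le
          ((∂_{z} φ).continuous.comp (by fun_prop : Continuous fun t : ℝ =>
            x + t • z)).aestronglyMeasurable
    _ = ∫⁻ t in Set.Icc (0 : ℝ) 1, ∫⁻ x, ‖(∂_{z} φ) (x + t • z)‖ₑ ^ 2 := by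
        refine lintegral_lintegral_swap ?_
        exact (hc.enorm.measurable.pow_const 2).aemeasurable
    _ = ∫⁻ t in Set.Icc (0 : ℝ) 1, ∫⁻ x, ‖(∂_{z} φ) x‖ₑ ^ 2 := by
        refine lintegral_congr fun t => ?_
        exact lintegral_add_right_eq_self (μ := volume)
          (fun x => ‖(∂_{z} φ : 𝓓(Ω, ℝ)) x‖ₑ ^ 2) (t • z)
    _ = _ := by simp

theorem norm_toL2_lineDerivOp_sq_le (φ : 𝓓(Ω, ℝ)) (z : EuclideanSpace ℝ (Fin n)) :
    ‖toL2 Ω (∂_{z} φ)‖ ^ 2 ≤ ‖z‖ ^ 2 * ∑ i : Fin n, ‖toL2 Ω (∂_{e i} φ)‖ ^ 2 := by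
  have hz : z = ∑ i : Fin n, z i • e i := by
    ext j
    simp [Pi.single_apply]
  have h1 : ∂_{z} φ = ∑ i : Fin n, z i • ∂_{e i} φ := by
    conv_lhs => rw [hz]
    rw [LineDeriv.lineDerivOp_left_sum]
    exact Finset.sum_congr rfl fun i _ => LineDeriv.lineDerivOp_left_smul _ _ _
  have h2 : ‖toL2 Ω (∂_{z} φ)‖ ≤ ∑ i : Fin n, |z i| * ‖toL2 Ω (∂_{e i} φ)‖ := by
    rw [h1, map_sum]
    refine (norm_sum_le _ _).trans (le_of_eq ?_)
    exact Finset.sum_congr rfl fun i _ => by rw [map_smul, norm_smul, Real.norm_eq_abs]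
  refine (pow_le_pow_left₀ (norm_nonneg _) h2 2).trans ?_
  refine (Finset.sum_mul_sq_le_sq_mul_sq _ _ _).trans (le_of_eq ?_)
  rw [EuclideanSpace.real_norm_sq_eq]
  simp only [sq_abs]

/-- The half-open cube of side `δ` with index `k`. -/
def cube (δ : ℝ) (k : Fin n → ℤ) : Set (EuclideanSpace ℝ (Fin n)) :=
  {x | ∀ i, ⌊x i / δ⌋ = k i}

/-- The open box of all differences of two points in a common cube of side `δ`. -/
def diffBox (n : ℕ) (δ : ℝ) : Set (EuclideanSpace ℝ (Fin n)) := {x | ∀ i, |x i| < δ}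

theorem cube_eq {δ : ℝ} (hδ : 0 < δ) (k : Fin n → ℤ) :
    cube δ k = (WithLp.ofLp : EuclideanSpace ℝ (Fin n) → (Fin n → ℝ)) ⁻¹'
      (Set.univ.pi fun i => Set.Ico (k i * δ) ((k i + 1) * δ)) := by
  ext x
  simp [cube, Int.floor_eq_iff, le_div_iff₀ hδ, div_lt_iff₀ hδ]

theorem diffBox_eq (δ : ℝ) :
    diffBox n δ = (WithLp.ofLp : EuclideanSpace ℝ (Fin n) → (Fin n → ℝ)) ⁻¹'
      (Set.univ.pi fun _ => Set.Ioo (-δ) δ) := by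
  ext x
  simp [diffBox, abs_lt]

theorem measurableSet_cube {δ : ℝ} (hδ : 0 < δ) (k : Fin n → ℤ) : MeasurableSet (cube δ k) := by
  rw [cube_eq hδ]
  exact (MeasurableSet.univ_pi fun i => measurableSet_Ico).preimage
    (PiLp.volume_preserving_ofLp _).measurable

theorem measurableSet_diffBox (δ : ℝ) : MeasurableSet (diffBox n δ) := by
  rw [diffBox_eq]
  exact (MeasurableSet.univ_pi fun i => measurableSet_Ioo).preimage
    (PiLp.volume_preserving_ofLp _).measurable

theorem volume_cube {δ : ℝ} (hδ : 0 < δ) (k : Fin n → ℤ) :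
    volume (cube δ k) = ENNReal.ofReal δ ^ n := by
  rw [cube_eq hδ, (PiLp.volume_preserving_ofLp _).measure_preimage
    (MeasurableSet.univ_pi fun i => measurableSet_Ico).nullMeasurableSet, Real.volume_pi_Ico]
  simp [add_mul]

theorem volume_diffBox (δ : ℝ) : volume (diffBox n δ) = 2 ^ n * ENNReal.ofReal δ ^ n := by
  rw [diffBox_eq, (PiLp.volume_preserving_ofLp _).measure_preimage
    (MeasurableSet.univ_pi fun i => measurableSet_Ioo).nullMeasurableSet, Real.volume_pi_Ioo]
  rw [Finset.prod_const, Finset.card_univ, Fintype.card_fin, ← mul_pow,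
    show δ - -δ = 2 * δ by ring, ENNReal.ofReal_mul zero_le_two, ENNReal.ofReal_ofNat]

theorem pairwise_disjoint_cube (δ : ℝ) : Pairwise (Function.onFun Disjoint (cube (n := n) δ)) := by
  intro k l hkl
  refine Set.disjoint_left.2 fun x hx hx' => hkl (funext fun i => ?_)
  rw [← hx i, hx' i]

theorem sub_mem_diffBox {δ : ℝ} (hδ : 0 < δ) {k : Fin n → ℤ} {x y : EuclideanSpace ℝ (Fin n)}
    (hx : x ∈ cube δ k) (hy : y ∈ cube δ k) : y - x ∈ diffBox n δ := by
  intro i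
  have h := Int.abs_sub_lt_one_of_floor_eq_floor ((hy i).trans (hx i).symm)
  rw [← sub_div, abs_div, abs_of_pos hδ, div_lt_one hδ] at h
  exact h

theorem norm_sq_le_of_mem_diffBox {δ : ℝ} {z : EuclideanSpace ℝ (Fin n)} (hz : z ∈ diffBox n δ) :
    ‖z‖ ^ 2 ≤ n * δ ^ 2 := by
  rw [EuclideanSpace.real_norm_sq_eq]
  calc ∑ i, z i ^ 2 ≤ ∑ _i : Fin n, δ ^ 2 :=
        Finset.sum_le_sum fun i _ => sq_le_sq' (abs_lt.1 (hz i)).1.le (abs_lt.1 (hz i)).2.le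
    _ = _ := by simp

end Rellich

/-! ### Step-function approximation and Rellich's theorem. -/

section Compactness

open scoped ENNReal

variable {n : ℕ} {Ω : Opens (EuclideanSpace ℝ (Fin n))}

theorem exists_finset_cover (hb : Bornology.IsBounded (Ω : Set (EuclideanSpace ℝ (Fin n))))
    (δ : ℝ) (hδ : 0 < δ) : ∃ F : Finset (Fin n → ℤ),
      (Ω : Set (EuclideanSpace ℝ (Fin n))) ⊆ ⋃ k ∈ F, cube δ k := by
  obtain ⟨C, hC⟩ := hb.exists_norm_le
  refine ⟨Fintype.piFinset fun _ => Finset.Icc ⌊-C / δ⌋ ⌊C / δ⌋, fun x hx => ?_⟩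
  refine Set.mem_biUnion (x := fun i => ⌊x i / δ⌋) ?_ (fun i => rfl)
  simp only [Finset.mem_coe, Fintype.mem_piFinset, Finset.mem_Icc]
  intro i
  have h := abs_le.1 ((PiLp.norm_apply_le x i).trans (hC x hx))
  exact ⟨Int.floor_le_floor (by gcongr; exact h.1), Int.floor_le_floor (by gcongr; exact h.2)⟩

/-- Jensen for the average over the cube, then `y = x + z`. Enlarging the range of `z` to `diffBox`
makes it independent of `x` and `k`, so that cubes can be summed and integrals exchanged. -/
theorem lintegral_cube_sub_average_le (φ : 𝓓(Ω, ℝ)) {δ : ℝ} (hδ : 0 < δ) (k : Fin n → ℤ) :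
    ∫⁻ x in cube δ k, ‖φ x - ∫ y, φ y ∂(ProbabilityTheory.cond volume (cube δ k))‖ₑ ^ 2 ≤
      ∫⁻ x in cube δ k, (ENNReal.ofReal δ ^ n)⁻¹ *
        ∫⁻ z in diffBox n δ, ‖φ (x + z) - φ x‖ₑ ^ 2 := by
  have hV0 : volume (cube δ k) ≠ 0 := by simp [volume_cube hδ, hδ]
  have hVt : volume (cube δ k) ≠ ⊤ := by simp [volume_cube hδ]
  have hp : IsProbabilityMeasure (ProbabilityTheory.cond volume (cube δ k)) :=
    ProbabilityTheory.cond_isProbabilityMeasure_of_finite hV0 hVt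
  have hi : Integrable φ (ProbabilityTheory.cond volume (cube δ k)) :=
    ((φ.continuous.integrable_of_hasCompactSupport φ.hasCompactSupport).restrict).smul_measure
      (ENNReal.inv_ne_top.2 hV0)
  refine setLIntegral_mono' (measurableSet_cube hδ k) fun x hx => ?_
  have h1 : φ x - ∫ y, φ y ∂(ProbabilityTheory.cond volume (cube δ k)) =
      ∫ y, (φ x - φ y) ∂(ProbabilityTheory.cond volume (cube δ k)) := by
    rw [integral_sub (integrable_const _) hi]
    simp
  rw [h1]
  refine (enorm_integral_sq_le (f := fun y => φ x - φ y)
    ((integrable_const _).sub hi).aestronglyMeasurable).trans ?_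
  rw [ProbabilityTheory.cond, lintegral_smul_measure, volume_cube hδ, smul_eq_mul]
  refine mul_le_mul' le_rfl ?_
  rw [← lintegral_indicator (measurableSet_cube hδ k),
    ← lintegral_indicator (measurableSet_diffBox δ),
    ← lintegral_add_left_eq_self (μ := volume)
      ((cube δ k).indicator fun y => ‖φ x - φ y‖ₑ ^ 2) x]
  refine lintegral_mono fun z => ?_
  by_cases hz : x + z ∈ cube δ k
  · have hz' : z ∈ diffBox n δ := by simpa using sub_mem_diffBox hδ hx hz
    rw [Set.indicator_of_mem hz, Set.indicator_of_mem hz', enorm_sub_rev]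
  · rw [Set.indicator_of_notMem hz]
    exact zero_le

theorem sum_lintegral_cube_le (φ : 𝓓(Ω, ℝ)) {δ : ℝ} (hδ : 0 < δ) (F : Finset (Fin n → ℤ)) :
    ∑ k ∈ F, ∫⁻ x in cube δ k,
        ‖φ x - ∫ y, φ y ∂(ProbabilityTheory.cond volume (cube δ k))‖ₑ ^ 2 ≤
      ENNReal.ofReal (2 ^ n * (n * δ ^ 2 * ∑ i : Fin n, ‖toL2 Ω (∂_{e i} φ)‖ ^ 2)) := by
  set D := ∑ i : Fin n, ‖toL2 Ω (∂_{e i} φ)‖ ^ 2 with hD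
  have hD0 : 0 ≤ D := by positivity
  have hV0 : ENNReal.ofReal δ ^ n ≠ 0 := by simp [hδ]
  have hVt : ENNReal.ofReal δ ^ n ≠ ⊤ := by simp
  have hc : Continuous fun p : EuclideanSpace ℝ (Fin n) × EuclideanSpace ℝ (Fin n) =>
      φ (p.1 + p.2) - φ p.1 :=
    (φ.continuous.comp (by fun_prop)).sub (φ.continuous.comp continuous_fst)
  calc _ ≤ ∑ k ∈ F, ∫⁻ x in cube δ k, (ENNReal.ofReal δ ^ n)⁻¹ *
        ∫⁻ z in diffBox n δ, ‖φ (x + z) - φ x‖ₑ ^ 2 :=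
        Finset.sum_le_sum fun k _ => lintegral_cube_sub_average_le φ hδ k
    _ = ∫⁻ x in ⋃ k ∈ F, cube δ k, (ENNReal.ofReal δ ^ n)⁻¹ *
        ∫⁻ z in diffBox n δ, ‖φ (x + z) - φ x‖ₑ ^ 2 :=
        (lintegral_biUnion_finset (fun k _ l _ h => pairwise_disjoint_cube δ h)
          (fun k _ => measurableSet_cube hδ k) _).symm
    _ ≤ ∫⁻ x, (ENNReal.ofReal δ ^ n)⁻¹ *
        ∫⁻ z in diffBox n δ, ‖φ (x + z) - φ x‖ₑ ^ 2 := setLIntegral_le_lintegral _ _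
    _ = (ENNReal.ofReal δ ^ n)⁻¹ *
        ∫⁻ x, ∫⁻ z in diffBox n δ, ‖φ (x + z) - φ x‖ₑ ^ 2 :=
        lintegral_const_mul' _ _ (ENNReal.inv_ne_top.2 hV0)
    _ = (ENNReal.ofReal δ ^ n)⁻¹ *
        ∫⁻ z in diffBox n δ, ∫⁻ x, ‖φ (x + z) - φ x‖ₑ ^ 2 := by
        rw [lintegral_lintegral_swap]
        exact (hc.enorm.measurable.pow_const 2).aemeasurable
    _ ≤ (ENNReal.ofReal δ ^ n)⁻¹ * ∫⁻ _z in diffBox n δ, ENNReal.ofReal (n * δ ^ 2 * D) := by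
        gcongr 1
        refine setLIntegral_mono' (measurableSet_diffBox δ) fun z hz => ?_
        refine (lintegral_translate_sub_le φ z).trans ?_
        rw [lintegral_enorm_sq]
        refine ENNReal.ofReal_le_ofReal ((norm_toL2_lineDerivOp_sq_le φ z).trans ?_)
        exact mul_le_mul_of_nonneg_right (norm_sq_le_of_mem_diffBox hz) hD0
    -- `2 ^ n` is the ratio of the volumes of `diffBox` and a cube.
    _ = 2 ^ n * ENNReal.ofReal (n * δ ^ 2 * D) := by
        rw [setLIntegral_const, volume_diffBox,
          show (ENNReal.ofReal δ ^ n)⁻¹ * (ENNReal.ofReal (n * δ ^ 2 * D) *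
            (2 ^ n * ENNReal.ofReal δ ^ n)) = ((ENNReal.ofReal δ ^ n)⁻¹ * ENNReal.ofReal δ ^ n) *
            (2 ^ n * ENNReal.ofReal (n * δ ^ 2 * D)) by ring,
          ENNReal.inv_mul_cancel hV0 hVt, one_mul]
    _ = _ := by
        rw [ENNReal.ofReal_mul (p := 2 ^ n) (by positivity), ENNReal.ofReal_pow zero_le_two,
          ENNReal.ofReal_ofNat]

theorem restrict_cube_ne_top {δ : ℝ} (hδ : 0 < δ) (k : Fin n → ℤ) :
    volume.restrict (Ω : Set (EuclideanSpace ℝ (Fin n))) (cube δ k) ≠ ⊤ := by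
  refine ((Measure.restrict_apply_le _ _).trans_lt ?_).ne
  simp [volume_cube hδ]

/-- The span of the indicator functions of finitely many cubes. -/
noncomputable def stepSpace (Ω : Opens (EuclideanSpace ℝ (Fin n))) {δ : ℝ} (hδ : 0 < δ)
    (F : Finset (Fin n → ℤ)) : Submodule ℝ (L2 Ω) :=
  Submodule.span ℝ (Set.range fun k : F =>
    indicatorConstLp 2 (measurableSet_cube hδ k.1) (restrict_cube_ne_top hδ k.1) (1 : ℝ))

instance {δ : ℝ} (hδ : 0 < δ) (F : Finset (Fin n → ℤ)) :
    FiniteDimensional ℝ (stepSpace Ω hδ F) :=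
  FiniteDimensional.span_of_finite ℝ (Set.finite_range _)

/-- Approximation of test functions by step functions. -/
theorem exists_step_approx {δ : ℝ} (hδ : 0 < δ) {F : Finset (Fin n → ℤ)}
    (hF : (Ω : Set (EuclideanSpace ℝ (Fin n))) ⊆ ⋃ k ∈ F, cube δ k) (φ : 𝓓(Ω, ℝ)) :
    ∃ s ∈ stepSpace Ω hδ F,
      ‖toL2 Ω φ - s‖ ^ 2 ≤ 2 ^ n * (n * δ ^ 2 * ∑ i : Fin n, ‖toL2 Ω (∂_{e i} φ)‖ ^ 2) := by
  classical
  let a : (Fin n → ℤ) → ℝ := fun k => ∫ y, φ y ∂(ProbabilityTheory.cond volume (cube δ k))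
  let ind : (Fin n → ℤ) → L2 Ω := fun k =>
    indicatorConstLp 2 (measurableSet_cube hδ k) (restrict_cube_ne_top hδ k) (1 : ℝ)
  refine ⟨∑ k ∈ F, a k • ind k, Submodule.sum_mem _ fun k hk => Submodule.smul_mem _ _
    (Submodule.subset_span ⟨⟨k, hk⟩, rfl⟩), ?_⟩
  have hcoe : (∑ k ∈ F, a k • ind k : L2 Ω)
      =ᵐ[volume.restrict (Ω : Set (EuclideanSpace ℝ (Fin n)))]
      fun x => ∑ k ∈ F, a k * (cube δ k).indicator (fun _ => 1) x := by
    have h1 : ∀ᵐ x ∂(volume.restrict (Ω : Set (EuclideanSpace ℝ (Fin n)))), ∀ k ∈ F,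
        (a k • ind k : L2 Ω) x = a k * (cube δ k).indicator (fun _ => 1) x := by
      rw [Finset.eventually_all]
      intro k _
      filter_upwards [Lp.coeFn_smul (a k) (ind k), indicatorConstLp_coeFn (p := 2)
        (hs := measurableSet_cube hδ k) (hμs := restrict_cube_ne_top (Ω := Ω) hδ k)
        (c := (1 : ℝ))] with x hx hx'
      rw [hx, Pi.smul_apply, hx', smul_eq_mul]
    filter_upwards [Lp.coeFn_finsetSum F (fun k => a k • ind k), h1] with x hx hx'
    rw [hx, Finset.sum_apply]
    exact Finset.sum_congr rfl fun k hk => hx' k hk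
  have key : ‖toL2 Ω φ - ∑ k ∈ F, a k • ind k‖ₑ ^ 2 ≤
      ENNReal.ofReal (2 ^ n * (n * δ ^ 2 * ∑ i : Fin n, ‖toL2 Ω (∂_{e i} φ)‖ ^ 2)) := by
    refine le_trans ?_ (sum_lintegral_cube_le φ hδ F)
    rw [Lp.enorm_def, eLpNorm_two_sq]
    calc _ = ∫⁻ x in (Ω : Set (EuclideanSpace ℝ (Fin n))),
          ‖φ x - ∑ k ∈ F, a k * (cube δ k).indicator (fun _ => 1) x‖ₑ ^ 2 := by
          refine lintegral_congr_ae ?_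
          filter_upwards [Lp.coeFn_sub (toL2 Ω φ) (∑ k ∈ F, a k • ind k), toL2_coe φ, hcoe]
            with x h1 h2 h3
          rw [h1, Pi.sub_apply, h2, h3]
      _ ≤ ∫⁻ x in ⋃ k ∈ F, cube δ k,
          ‖φ x - ∑ k ∈ F, a k * (cube δ k).indicator (fun _ => 1) x‖ₑ ^ 2 :=
          lintegral_mono_set hF
      _ = ∑ k ∈ F, ∫⁻ x in cube δ k,
          ‖φ x - ∑ k ∈ F, a k * (cube δ k).indicator (fun _ => 1) x‖ₑ ^ 2 :=
          lintegral_biUnion_finset (fun k _ l _ h => pairwise_disjoint_cube δ h)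
            (fun k _ => measurableSet_cube hδ k) _
      _ ≤ _ := by
          refine Finset.sum_le_sum fun k hk => ?_
          refine setLIntegral_mono' (measurableSet_cube hδ k) fun x hx => ?_
          rw [Finset.sum_eq_single k]
          · simp [hx, a]
          · intro l _ hl
            rw [Set.indicator_of_notMem, mul_zero]
            exact fun hx' => Set.disjoint_left.1 (pairwise_disjoint_cube δ hl) hx' hx
          · exact fun h => absurd hk h
  have h2 : ‖toL2 Ω φ - ∑ k ∈ F, a k • ind k‖ₑ ^ 2 =
      ENNReal.ofReal (‖toL2 Ω φ - ∑ k ∈ F, a k • ind k‖ ^ 2) := by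
    rw [ENNReal.ofReal_pow (norm_nonneg _), ofReal_norm]
  rw [h2] at key
  exact (ENNReal.ofReal_le_ofReal_iff (by positivity)).1 key

/-- The inclusion of `H²₀(Ω)` in `L²(Ω)`. -/
noncomputable def valL (Ω : Opens (EuclideanSpace ℝ (Fin n))) : H20 Ω →L[ℝ] L2 Ω :=
  (PiLp.proj 2 (fun _ : Unit ⊕ Fin n ⊕ (Fin n × Fin n) => L2 Ω) (Sum.inl ())).comp
    (H20 Ω).subtypeL

/-- **Rellich's theorem**: the inclusion of `H²₀(Ω)` in `L²(Ω)` is compact for bounded `Ω`. -/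
theorem isCompactOperator_valL
    (hb : Bornology.IsBounded (Ω : Set (EuclideanSpace ℝ (Fin n)))) :
    IsCompactOperator (valL Ω) := by
  have hδ : ∀ m : ℕ, (0 : ℝ) < 1 / (m + 1) := fun m => Nat.one_div_pos_of_nat
  choose F hF using fun m => exists_finset_cover hb _ (hδ m)
  let S : ℕ → Submodule ℝ (L2 Ω) := fun m => stepSpace Ω (hδ m) (F m)
  have hfd : ∀ m, FiniteDimensional ℝ (S m) := fun m => inferInstance
  -- Projections onto step functions on cubes of side `1 / (m + 1)`. These have finite rank, and
  -- composed with the inclusion they converge to it in operator norm.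
  let P : ℕ → (L2 Ω →L[ℝ] L2 Ω) := fun m => (S m).starProjection
  refine isCompactOperator_of_tendsto (l := atTop) (F := fun m => (P m).comp (valL Ω)) ?_
    (Eventually.of_forall fun m => ?_)
  · refine (tendsto_iff_norm_sub_tendsto_zero (E := H20 Ω →L[ℝ] L2 Ω)).2 ?_
    have hbound : ∀ m, ‖(P m).comp (valL Ω) - valL Ω‖ ≤
        Real.sqrt (2 ^ n * n) * (1 / ((m : ℝ) + 1)) := by
      intro m
      refine ContinuousLinearMap.opNorm_le_bound _ (by positivity) fun u => ?_
      have h1 : ‖(u : Jet Ω).val - P m (u : Jet Ω).val‖ ^ 2 ≤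
          2 ^ n * (n * (1 / ((m : ℝ) + 1)) ^ 2 * ∑ i, ‖(u : Jet Ω).d i‖ ^ 2) := by
        refine H20_induction (P := fun u => ‖u.val - P m u.val‖ ^ 2 ≤
          2 ^ n * (n * (1 / ((m : ℝ) + 1)) ^ 2 * ∑ i, ‖u.d i‖ ^ 2))
          (isClosed_le (by fun_prop) (by fun_prop)) (fun φ => ?_) u.2
        obtain ⟨s, hs, hφ⟩ := exists_step_approx (hδ m) (hF m) φ
        refine le_trans ?_ hφ
        gcongr
        rw [jet_val, Submodule.starProjection_minimal]
        exact ciInf_le ⟨0, by rintro _ ⟨x, rfl⟩; exact norm_nonneg _⟩ (⟨s, hs⟩ : S m)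
      have h2 : ∑ i, ‖(u : Jet Ω).d i‖ ^ 2 ≤ ‖u‖ ^ 2 := by
        have h3 := Jet.norm_sq_eq (u : Jet Ω)
        have h4 : 0 ≤ ∑ i, ∑ j, ‖(u : Jet Ω).dd i j‖ ^ 2 := by positivity
        rw [Submodule.coe_norm, h3]
        nlinarith [sq_nonneg ‖(u : Jet Ω).val‖]
      have h5 : ‖((P m).comp (valL Ω) - valL Ω) u‖ = ‖(u : Jet Ω).val - P m (u : Jet Ω).val‖ := by
        rw [sub_apply, norm_sub_rev]
        rfl
      rw [h5]
      refine le_of_sq_le_sq ?_ (by positivity)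
      refine h1.trans ?_
      rw [mul_pow, mul_pow, Real.sq_sqrt (by positivity)]
      calc _ ≤ 2 ^ n * (n * (1 / ((m : ℝ) + 1)) ^ 2 * ‖u‖ ^ 2) := by gcongr
        _ = _ := by ring
    refine squeeze_zero (fun m => by positivity) hbound ?_
    simpa using tendsto_one_div_add_atTop_nhds_zero_nat.const_mul (Real.sqrt (2 ^ n * n))
  · have : ProperSpace (S m) := FiniteDimensional.proper ℝ (S m)
    have h : IsCompactOperator (P m) := isCompactOperator_of_locallyCompactSpace_rng (S m).subtypeL
      |>.comp_clm (S m).orthogonalProjectionOnto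
    exact h.comp_clm (valL Ω)

end Compactness

/-! ### The compact operator and infinite dimensionality. -/

section Operator

open Module.End

variable {n : ℕ} {Ω : Opens (EuclideanSpace ℝ (Fin n))}

/-- The Laplacian `H²₀(Ω) → L²(Ω)`. -/
noncomputable def lapL (Ω : Opens (EuclideanSpace ℝ (Fin n))) : H20 Ω →L[ℝ] L2 Ω where
  toFun u := (u : Jet Ω).lap
  map_add' u w := by simp [Jet.lap, Jet.dd, Finset.sum_add_distrib]
  map_smul' c u := by simp [Jet.lap, Jet.dd, Finset.smul_sum]
  cont := Jet.continuous_lap.comp continuous_subtype_val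

theorem inner_val_lap_eq {u w : Jet Ω} (hu : u ∈ H20 Ω) (hw : w ∈ H20 Ω) :
    inner ℝ u.val w.lap = -gradForm u w := by
  simp only [gradForm_eq_inner, Jet.lap, inner_sum, ← Finset.sum_neg_distrib]
  refine Finset.sum_congr rfl fun i _ => ?_
  refine H20_induction (P := fun u => inner ℝ u.val (w.dd i i) = -inner ℝ (u.d i) (w.d i))
    (isClosed_eq (by fun_prop) (by fun_prop)) (fun φ => ?_) hu
  refine H20_induction (P := fun w => inner ℝ (jet Ω φ).val (w.dd i i) =
    -inner ℝ ((jet Ω φ).d i) (w.d i))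
    (isClosed_eq (by fun_prop) (by fun_prop)) (fun ψ => ?_) hw
  exact inner_toL2_lineDerivOp (e i) φ _

/-- The buckling problem as the eigenvalue problem of a compact operator `T`, on the Hilbert space
`Δ(H²₀(Ω))`. -/
theorem exists_compact_operator (hn : 1 ≤ n)
    (hb : Bornology.IsBounded (Ω : Set (EuclideanSpace ℝ (Fin n)))) :
    ∃ (K : Type) (_ : NormedAddCommGroup K) (_ : InnerProductSpace ℝ K) (_ : CompleteSpace K)
      (S : H20 Ω ≃ₗ[ℝ] K) (T : K →L[ℝ] K), IsCompactOperator T ∧ (∀ u w : H20 Ω, inner ℝ (S u) (S w) = lapForm (u : Jet Ω) w) ∧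
      ∀ u w : H20 Ω, inner ℝ (T (S u)) (S w) = gradForm (u : Jet Ω) w := by
  obtain ⟨C, hC0, hC⟩ := exists_norm_sq_le hb hn
  have hbound : ∀ u : H20 Ω, ‖u‖ ≤ Real.sqrt C * ‖lapL Ω u‖ := by
    intro u
    refine le_of_sq_le_sq ?_ (by positivity)
    rw [mul_pow, Real.sq_sqrt hC0.le]
    exact (hC u u.2).1
  -- Bounded below, the Laplacian is injective with complete range.
  have hanti : AntilipschitzWith (Real.toNNReal (Real.sqrt C)) (lapL Ω) := by
    refine AddMonoidHomClass.antilipschitz_of_bound _ fun u => ?_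
    rw [Real.coe_toNNReal _ (Real.sqrt_nonneg C)]
    exact hbound u
  have hH : CompleteSpace (H20 Ω) :=
    (Submodule.isClosed_topologicalClosure _).completeSpace_coe
  have hK : CompleteSpace (LinearMap.range (lapL Ω).toLinearMap) :=
    completeSpace_coe_iff_isComplete.2 (hanti.isComplete_range (lapL Ω).uniformContinuous)
  let S : H20 Ω ≃ₗ[ℝ] LinearMap.range (lapL Ω).toLinearMap :=
    LinearEquiv.ofInjective (lapL Ω).toLinearMap hanti.injective
  have hS : ∀ u, (S u : L2 Ω) = lapL Ω u := fun u => rfl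
  let R : LinearMap.range (lapL Ω).toLinearMap →L[ℝ] H20 Ω :=
    S.symm.toLinearMap.mkContinuous (Real.sqrt C) fun k => by
      have := hbound (S.symm k)
      rw [← hS, S.apply_symm_apply] at this
      exact this
  -- `T` sends `Δu` to the projection of `-u`. Projecting does not alter pairings with `Δw`, and
  -- `-⟪u, Δw⟫` is the gradient form.
  let T : LinearMap.range (lapL Ω).toLinearMap →L[ℝ] LinearMap.range (lapL Ω).toLinearMap :=
    -((LinearMap.range (lapL Ω).toLinearMap).orthogonalProjectionOnto.comp ((valL Ω).comp R))
  refine ⟨_, _, _, hK, S, T, ?_, fun u w => ?_, fun u w => ?_⟩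
  · exact (((isCompactOperator_valL hb).comp_clm R).clm_comp
      (LinearMap.range (lapL Ω).toLinearMap).orthogonalProjectionOnto).neg
  · rw [lapForm_eq_inner]
    rfl
  · have h1 : T (S u) =
        -(LinearMap.range (lapL Ω).toLinearMap).orthogonalProjectionOnto (valL Ω u) := by
      have : R (S u) = u := S.symm_apply_apply u
      change -(LinearMap.range (lapL Ω).toLinearMap).orthogonalProjectionOnto
        (valL Ω (R (S u))) = _
      rw [this]
    rw [h1, inner_neg_left, Submodule.inner_orthogonalProjectionOnto_eq_of_mem_right]
    have h2 := inner_val_lap_eq u.2 w.2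
    change -inner ℝ (u : Jet Ω).val (w : Jet Ω).lap = _
    rw [h2, neg_neg]

theorem exists_testFunction_ne_zero (hΩ : (Ω : Set (EuclideanSpace ℝ (Fin n))).Nonempty) :
    ∃ φ : 𝓓(Ω, ℝ), toL2 Ω φ ≠ 0 := by
  obtain ⟨x, hx⟩ := hΩ
  obtain ⟨f, hf1, hf2, hf3, -, hf5⟩ := exists_contDiff_tsupport_subset (n := ⊤)
    (Ω.isOpen.mem_nhds hx)
  let φ : 𝓓(Ω, ℝ) := ⟨f, hf3, hf2, hf1⟩
  refine ⟨φ, fun h => ?_⟩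
  have h1 := inner_toL2 φ φ
  rw [h, inner_zero_left] at h1
  have hc : Continuous fun y => φ y * φ y := φ.continuous.mul φ.continuous
  have h2 : 0 < ∫ y, φ y * φ y :=
    hc.integral_pos_of_hasCompactSupport_nonneg_nonzero φ.hasCompactSupport.mul_right
      (fun y => mul_self_nonneg (φ y)) (x := x) (by
        have : φ x = 1 := hf5
        simp [this])
  linarith

/-- Multiplication by a coordinate has no eigenvectors in `L²(Ω)`. -/
theorem eq_zero_of_mulL_eq_smul (hb : Bornology.IsBounded (Ω : Set (EuclideanSpace ℝ (Fin n))))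
    (i : Fin n) {g : L2 Ω} {c : ℝ} (h : mulL hb (e i) g = c • g) : g = 0 := by
  have hnull : volume {x : EuclideanSpace ℝ (Fin n) | x i = c} = 0 := by
    have h1 := Measure.pi_hyperplane (fun _ : Fin n => (volume : Measure ℝ)) i c
    have h2 : MeasurableSet {f : Fin n → ℝ | f i = c} :=
      (measurableSet_singleton c).preimage (measurable_pi_apply i)
    rw [← volume_pi, ← (PiLp.volume_preserving_ofLp (Fin n)).measure_preimage
      h2.nullMeasurableSet] at h1
    exact h1
  have hae : ∀ᵐ x ∂(volume.restrict (Ω : Set (EuclideanSpace ℝ (Fin n)))), x i ≠ c :=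
    ae_restrict_of_ae (by rw [ae_iff]; simpa using hnull)
  refine Lp.ext ?_
  have h3 := mulL_coe hb (e i) g
  rw [h] at h3
  filter_upwards [h3, Lp.coeFn_smul c g, hae, Lp.coeFn_zero ℝ 2
    (volume.restrict (Ω : Set (EuclideanSpace ℝ (Fin n))))] with x h4 h5 h6 h7
  rw [h7]
  rw [h5, EuclideanSpace.inner_single_left] at h4
  simp only [Pi.smul_apply, smul_eq_mul, map_one, one_mul] at h4
  have : (x i - c) * g x = 0 := by linarith
  exact (mul_eq_zero.1 this).resolve_left (sub_ne_zero.2 h6)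

/-- A finite-dimensional image in `L²` would be invariant under the symmetric multiplication by a
coordinate, which would then have an eigenvector. -/
theorem not_finiteDimensional_H20 (hn : 1 ≤ n)
    (hΩ : (Ω : Set (EuclideanSpace ℝ (Fin n))).Nonempty)
    (hb : Bornology.IsBounded (Ω : Set (EuclideanSpace ℝ (Fin n)))) :
    ¬ FiniteDimensional ℝ (H20 Ω) := by
  intro hfd
  let i₀ : Fin n := ⟨0, hn⟩
  let V := LinearMap.range (valL Ω).toLinearMap
  have hV : FiniteDimensional ℝ V := inferInstance
  have hinv : ∀ g ∈ V, (mulL hb (e i₀)).toLinearMap g ∈ V := by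
    rintro _ ⟨u, rfl⟩
    exact ⟨⟨mulJet hb (e i₀) u, mulJet_mem_H20 hb _ u.2⟩, rfl⟩
  have hsymm : (mulL hb (e i₀)).toLinearMap.IsSymmetric := inner_mulL_left hb (e i₀)
  have hsymm' := hsymm.restrict_invariant hinv
  obtain ⟨φ, hφ⟩ := exists_testFunction_ne_zero hΩ
  have hφV : toL2 Ω φ ∈ V := ⟨⟨jet Ω φ, jet_mem_H20 φ⟩, rfl⟩
  have : Nontrivial V := ⟨⟨toL2 Ω φ, hφV⟩, 0, fun h => hφ (congrArg Subtype.val h)⟩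
  obtain ⟨g, hg, hg0⟩ := hsymm'.hasEigenvalue_iSup_of_finiteDimensional.exists_hasEigenvector
  rw [mem_eigenspace_iff] at hg
  exact hg0 (Subtype.ext (eq_zero_of_mulL_eq_smul hb i₀ (congrArg Subtype.val hg)))

end Operator

/-! ### The buckling spectrum and the eigenvalue inequality. -/

section Spectrum

open Module.End

variable {n : ℕ} {Ω : Opens (EuclideanSpace ℝ (Fin n))}

theorem lap_eq_zero_of_gradForm_eq_zero {u : Jet Ω} (hu : u ∈ H20 Ω) (h : gradForm u u = 0) :
    u.lap = 0 := by
  rw [gradForm_self, Finset.sum_eq_zero_iff_of_nonneg fun i _ => sq_nonneg _] at h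
  have hd : ∀ i, u.d i = 0 := fun i => by simpa using h i (Finset.mem_univ i)
  simp [Jet.lap, dd_eq_zero_of_d_eq_zero hu hd]

section

variable {K : Type*} [NormedAddCommGroup K] [InnerProductSpace ℝ K] {S : H20 Ω ≃ₗ[ℝ] K} {T : K →L[ℝ] K}

theorem isSymmetric_of_inner_eq
    (hT : ∀ u w : H20 Ω, inner ℝ (T (S u)) (S w) = gradForm (u : Jet Ω) w) :
    (T : K →ₗ[ℝ] K).IsSymmetric := by
  intro x y
  obtain ⟨u, rfl⟩ := S.surjective x
  obtain ⟨w, rfl⟩ := S.surjective y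
  change inner ℝ (T (S u)) (S w) = inner ℝ (S u) (T (S w))
  rw [hT, real_inner_comm, hT, gradForm_comm]

theorem inner_pos_of_inner_eq
    (hS : ∀ u w : H20 Ω, inner ℝ (S u) (S w) = lapForm (u : Jet Ω) w)
    (hT : ∀ u w : H20 Ω, inner ℝ (T (S u)) (S w) = gradForm (u : Jet Ω) w) {x : K} (hx : x ≠ 0) :
    0 < inner ℝ (T x) x := by
  obtain ⟨u, rfl⟩ := S.surjective x
  rw [hT]
  refine lt_of_le_of_ne (by rw [gradForm_self]; positivity) fun h => hx ?_
  rw [← inner_self_eq_zero (𝕜 := ℝ), hS, lapForm_self,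
    lap_eq_zero_of_gradForm_eq_zero u.2 h.symm]
  simp

theorem injective_of_inner_eq
    (hS : ∀ u w : H20 Ω, inner ℝ (S u) (S w) = lapForm (u : Jet Ω) w)
    (hT : ∀ u w : H20 Ω, inner ℝ (T (S u)) (S w) = gradForm (u : Jet Ω) w) :
    Function.Injective T := by
  refine (injective_iff_map_eq_zero T).2 fun x hx => ?_
  by_contra h
  have := inner_pos_of_inner_eq hS hT h
  rw [hx, inner_zero_left] at this
  exact lt_irrefl _ this

theorem mem_eigenspace_iff_of_inner_eq
    (hS : ∀ u w : H20 Ω, inner ℝ (S u) (S w) = lapForm (u : Jet Ω) w)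
    (hT : ∀ u w : H20 Ω, inner ℝ (T (S u)) (S w) = gradForm (u : Jet Ω) w) (μ : ℝ) (u : H20 Ω) :
    (u : Jet Ω) ∈ Buckling.eigenspace Ω μ ↔
      S u ∈ Module.End.eigenspace (T : K →ₗ[ℝ] K) μ⁻¹ := by
  have h1 : (u : Jet Ω) ∈ Buckling.eigenspace Ω μ ↔ S u = μ • T (S u) := by
    constructor
    · rintro ⟨-, h⟩
      refine ext_inner_right ℝ fun y => ?_
      obtain ⟨w, rfl⟩ := S.surjective y
      rw [real_inner_smul_left, hS, hT]
      exact h w w.2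
    · intro h
      refine ⟨u.2, fun w hw => ?_⟩
      rw [← hS u ⟨w, hw⟩, ← hT u ⟨w, hw⟩, ← real_inner_smul_left, ← h]
  rw [h1, mem_eigenspace_iff]
  change _ ↔ T (S u) = μ⁻¹ • S u
  -- For `μ = 0` the convention `0⁻¹ = 0` is harmless: injectivity of `T` makes both eigenspaces
  -- trivial.
  rcases eq_or_ne μ 0 with rfl | hμ
  · rw [zero_smul, inv_zero, zero_smul, ← map_zero T, (injective_of_inner_eq hS hT).eq_iff,
      map_zero]
  · rw [eq_inv_smul_iff₀ hμ, eq_comm]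

theorem nonempty_eigenspace_equiv
    (hS : ∀ u w : H20 Ω, inner ℝ (S u) (S w) = lapForm (u : Jet Ω) w)
    (hT : ∀ u w : H20 Ω, inner ℝ (T (S u)) (S w) = gradForm (u : Jet Ω) w) (μ : ℝ) :
    Nonempty (Buckling.eigenspace Ω μ ≃ₗ[ℝ] Module.End.eigenspace (T : K →ₗ[ℝ] K) μ⁻¹) := by
  have h : Buckling.eigenspace Ω μ =
      ((Module.End.eigenspace (T : K →ₗ[ℝ] K) μ⁻¹).comap S.toLinearMap).map (H20 Ω).subtype := by
    ext u
    constructor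
    · intro hu
      exact ⟨⟨u, hu.1⟩, (mem_eigenspace_iff_of_inner_eq hS hT μ ⟨u, hu.1⟩).1 hu, rfl⟩
    · rintro ⟨u, hu, rfl⟩
      exact (mem_eigenspace_iff_of_inner_eq hS hT μ u).2 hu
  rw [h]
  exact ⟨(Submodule.equivMapOfInjective _ (H20 Ω).subtype_injective _).symm.trans
    (S.ofSubmodule' _)⟩

theorem pos_of_hasEigenvalue
    (hS : ∀ u w : H20 Ω, inner ℝ (S u) (S w) = lapForm (u : Jet Ω) w)
    (hT : ∀ u w : H20 Ω, inner ℝ (T (S u)) (S w) = gradForm (u : Jet Ω) w) {μ : ℝ}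
    (hμ : HasEigenvalue (T : K →ₗ[ℝ] K) μ) : 0 < μ := by
  obtain ⟨x, hx, hx0⟩ := hμ.exists_hasEigenvector
  have h : T x = μ • x := mem_eigenspace_iff.1 hx
  have h1 := inner_pos_of_inner_eq hS hT hx0
  rw [h, real_inner_smul_left] at h1
  exact pos_of_mul_pos_left h1 real_inner_self_nonneg

end

theorem exists_isSpectrum (hn : 1 ≤ n) (hΩ : (Ω : Set (EuclideanSpace ℝ (Fin n))).Nonempty)
    (hb : Bornology.IsBounded (Ω : Set (EuclideanSpace ℝ (Fin n)))) :
    ∃ Λ : ℕ → ℝ, IsSpectrum Ω Λ := by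
  obtain ⟨K, _, _, hK, S, T, hc, hS, hT⟩ := exists_compact_operator hn hb
  have hinj := injective_of_inner_eq hS hT
  have hsymm := isSymmetric_of_inner_eq hT
  have hfd := CompactSymmetric.finiteDimensional_eigenspace hc hinj
  have hfd' : ∀ μ, FiniteDimensional ℝ (Buckling.eigenspace Ω μ) := fun μ =>
    Module.Finite.equiv (nonempty_eigenspace_equiv hS hT μ).some.symm
  have hrank : ∀ μ, Module.finrank ℝ (Buckling.eigenspace Ω μ) ≠ 0 ↔
      HasEigenvalue (T : K →ₗ[ℝ] K) μ⁻¹ := fun μ => by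
    rw [(nonempty_eigenspace_equiv hS hT μ).some.finrank_eq, hasEigenvalue_iff, Ne,
      Submodule.finrank_eq_zero]
  have hKinf : ¬ FiniteDimensional ℝ K := fun h =>
    not_finiteDimensional_H20 hn hΩ hb (Module.Finite.equiv S.symm)
  have hfin : ∀ t, {μ | μ ≤ t ∧ Module.finrank ℝ (Buckling.eigenspace Ω μ) ≠ 0}.Finite := by
    intro t
    -- Eigenvalues `μ ≤ t` have inverses at least `(max t 1)⁻¹`; the maximum keeps the threshold
    -- positive when `t ≤ 0`.
    have hpos : 0 < (max t 1)⁻¹ := inv_pos.2 (lt_max_of_lt_right one_pos)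
    refine ((CompactSymmetric.finite_setOf_hasEigenvalue hc hsymm hpos).image Inv.inv).subset ?_
    rintro μ ⟨hμt, hμ⟩
    have hμ' := (hrank μ).1 hμ
    refine ⟨μ⁻¹, ⟨?_, hμ'⟩, inv_inv μ⟩
    exact inv_anti₀ (inv_pos.1 (pos_of_hasEigenvalue hS hT hμ')) (le_max_of_le_left hμt)
  have hinf : {μ | Module.finrank ℝ (Buckling.eigenspace Ω μ) ≠ 0}.Infinite := by
    have h := CompactSymmetric.infinite_setOf_hasEigenvalue hc hsymm hinj hKinf
    refine (h.image inv_injective.injOn).mono ?_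
    rintro _ ⟨μ, hμ, rfl⟩
    exact (hrank μ⁻¹).2 (by rw [inv_inv]; exact hμ)
  obtain ⟨Λ, h1, h2, h3⟩ := CompactSymmetric.exists_monotone_enumeration _ hfin hinf
  exact ⟨Λ, h1, h2, hfd', h3⟩

theorem mulL_eq_sum (hb : Bornology.IsBounded (Ω : Set (EuclideanSpace ℝ (Fin n))))
    (ξ : EuclideanSpace ℝ (Fin n)) (g : L2 Ω) :
    mulL hb ξ g = ∑ i, ξ i • mulL hb (e i) g := by
  refine Lp.ext ?_
  have h1 : ∀ᵐ x ∂(volume.restrict (Ω : Set (EuclideanSpace ℝ (Fin n)))), ∀ i,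
      (ξ i • mulL hb (e i) g : L2 Ω) x = ξ i * (x i * g x) := by
    rw [eventually_all]
    intro i
    filter_upwards [Lp.coeFn_smul (ξ i) (mulL hb (e i) g), mulL_coe hb (e i) g] with x h2 h3
    rw [h2, Pi.smul_apply, h3, EuclideanSpace.inner_single_left]
    simp
  filter_upwards [h1, mulL_coe hb ξ g,
    Lp.coeFn_finsetSum Finset.univ (fun i => ξ i • mulL hb (e i) g)] with x h2 h3 h4
  rw [h3, h4, Finset.sum_apply, PiLp.inner_apply, Finset.sum_mul]
  refine Finset.sum_congr rfl fun i _ => ?_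
  rw [h2]
  simp only [RCLike.inner_apply, conj_trivial]
  ring

/-- Linearity in `ξ` turns orthogonality of a trial function to `w` into orthogonality of `ξ` to a
fixed vector of `ℝⁿ`. -/
theorem gradForm_mulJet_eq_inner
    (hb : Bornology.IsBounded (Ω : Set (EuclideanSpace ℝ (Fin n))))
    (ξ : EuclideanSpace ℝ (Fin n)) (u w : Jet Ω) :
    gradForm w (mulJet hb ξ u) =
      inner ℝ ξ (WithLp.toLp 2 fun i => gradForm w (mulJet hb (e i) u)) := by
  have h : ∀ j, (mulJet hb ξ u).d j = ∑ i, ξ i • (mulJet hb (e i) u).d j := by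
    intro j
    simp only [mulJet_d, smul_add, Finset.sum_add_distrib, ← mulL_eq_sum, smul_smul,
      ← Finset.sum_smul]
    simp
  rw [PiLp.inner_apply]
  simp only [gradForm_eq_inner, h, inner_sum, real_inner_smul_right]
  rw [Finset.sum_comm]
  refine Finset.sum_congr rfl fun i _ => ?_
  simp [mul_comm]

theorem spectrum_sum_le (hn : 1 ≤ n)
    (hb : Bornology.IsBounded (Ω : Set (EuclideanSpace ℝ (Fin n)))) {Λ : ℕ → ℝ}
    (hΛ : IsSpectrum Ω Λ) :
    0 < Λ 0 ∧ (∑ i ∈ Finset.range n, Λ (i + 1)) / Λ 0 ≤ (n : ℝ) + 4 := by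
  obtain ⟨K, _, _, hK, S, T, hc, hS, hT⟩ := exists_compact_operator hn hb
  have hinj := injective_of_inner_eq hS hT
  have hsymm := isSymmetric_of_inner_eq hT
  obtain ⟨b, hbT⟩ := CompactSymmetric.exists_hilbertBasis_eigenvectors hc hsymm hinj hΛ.tendsto
    fun μ => (hΛ.multiplicity μ).trans (nonempty_eigenspace_equiv hS hT μ).some.finrank_eq
  have hbb : ∀ i, inner ℝ (b i) (b i) = (1 : ℝ) := fun i => by
    rw [real_inner_self_eq_norm_sq, b.orthonormal.1 i, one_pow]
  have hpos : ∀ i, 0 < Λ i := by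
    intro i
    have h := inner_pos_of_inner_eq hS hT (b.orthonormal.ne_zero i)
    rw [hbT, real_inner_smul_left, hbb, mul_one] at h
    exact inv_pos.1 h
  let v : ℕ → H20 Ω := fun i => S.symm (b i)
  have hSv : ∀ i, S (v i) = b i := fun i => S.apply_symm_apply _
  have hv : ∀ i, ∀ w ∈ H20 Ω, lapForm (v i : Jet Ω) w = Λ i * gradForm (v i : Jet Ω) w := by
    intro i
    have h : (v i : Jet Ω) ∈ Buckling.eigenspace Ω (Λ i) := by
      rw [mem_eigenspace_iff_of_inner_eq hS hT, hSv, mem_eigenspace_iff]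
      exact hbT i
    exact h.2
  have hvv : ∀ i j, i ≠ j → gradForm (v i : Jet Ω) (v j) = 0 := by
    intro i j hij
    rw [← hT, hSv, hSv, hbT, real_inner_smul_left, b.orthonormal.2 hij, mul_zero]
  let u : Jet Ω := (v 0 : Jet Ω)
  have hu : u ∈ H20 Ω := (v 0).2
  have hg : 0 < gradForm u u := by
    change 0 < gradForm (v 0 : Jet Ω) (v 0)
    rw [← hT, hSv]
    exact inner_pos_of_inner_eq hS hT (b.orthonormal.ne_zero 0)
  let f : Fin n → EuclideanSpace ℝ (Fin n) := fun j =>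
    WithLp.toLp 2 fun i => gradForm (v (j + 1) : Jet Ω) (mulJet hb (e i) u)
  -- `ξ k` is orthogonal to `f j` for `j < k`, hence `⟪ξ k, x⟫ u` to `v 1, …, v k`. This holds even
  -- if `f` is linearly dependent.
  let ξ := InnerProductSpace.gramSchmidtOrthonormalBasis (𝕜 := ℝ) (by simp) f
  have hξ : ∀ k, ‖ξ k‖ = 1 := fun k => ξ.orthonormal.1 k
  -- This choice removes the component along `u = v 0`.
  let a : Fin n → ℝ := fun k => gradForm u (mulJet hb (ξ k) u) / gradForm u u
  have hgap : ∀ k : Fin n, (Λ (k + 1) - Λ 0) * gradForm u u ≤ 4 * ∑ j, ‖u.ddir (ξ k) j‖ ^ 2 := by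
    intro k
    refine gap_le hb (hξ k) hu (hv 0) hg (a k) ?_
    have hφ : mulJet hb (ξ k) u - a k • u ∈ H20 Ω :=
      sub_mem (mulJet_mem_H20 hb _ hu) (Submodule.smul_mem _ _ hu)
    have horth : ∀ j < (k : ℕ) + 1,
        gradForm (v j : Jet Ω) (mulJet hb (ξ k) u - a k • u) = 0 := by
      intro j hj
      rw [gradForm_sub_smul]
      rcases j with _ | j
      · change gradForm u _ - _ * gradForm u u = 0
        rw [div_mul_cancel₀ _ hg.ne', sub_self]
      · rw [hvv (j + 1) 0 (Nat.succ_ne_zero j), mul_zero, sub_zero, gradForm_mulJet_eq_inner]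
        have hjk : j < k := Nat.lt_of_succ_lt_succ hj
        exact InnerProductSpace.gramSchmidtOrthonormalBasis_inv_triangular _ f
          (i := ⟨j, hjk.trans k.2⟩) (j := k) hjk
    have h := CompactSymmetric.inner_apply_self_le hsymm hΛ.monotone b hbT (hpos (k + 1))
      (u := S ⟨_, hφ⟩) fun j hj => by
        rw [← hSv, hS, hv j _ hφ, horth j hj, mul_zero]
    rw [hS, hT] at h
    exact h
  have hsum := Finset.sum_le_sum fun k (_ : k ∈ Finset.univ) => hgap k
  -- The right sides sum to `4 * lapForm u u = 4 * Λ 0 * gradForm u u`, and the factor `gradForm u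
  -- u` cancels.
  rw [← Finset.sum_mul, ← Finset.mul_sum, sum_ddir_sq ξ hu, hv 0 u hu, ← mul_assoc] at hsum
  have hsum' := le_of_mul_le_mul_right hsum hg
  rw [Finset.sum_sub_distrib, Fin.sum_univ_eq_sum_range (fun i => Λ (i + 1))] at hsum'
  refine ⟨hpos 0, (div_le_iff₀ (hpos 0)).2 ?_⟩
  simp only [Finset.sum_const, Finset.card_univ, Fintype.card_fin, nsmul_eq_mul] at hsum'
  linarith

end Spectrum

end Buckling

theorem mainTheorem8 (n : ℕ) (hn : 1 ≤ n)
    (Ω : TopologicalSpace.Opens (EuclideanSpace ℝ (Fin n)))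
    (hΩ : IsConnected (Ω : Set (EuclideanSpace ℝ (Fin n))))
    (hb : Bornology.IsBounded (Ω : Set (EuclideanSpace ℝ (Fin n)))) :
    (∃ Λ : ℕ → ℝ, Buckling.IsSpectrum Ω Λ) ∧
      ∀ Λ : ℕ → ℝ, Buckling.IsSpectrum Ω Λ →
        0 < Λ 0 ∧ (∑ i ∈ Finset.range n, Λ (i + 1)) / Λ 0 ≤ (n : ℝ) + 4 :=
  ⟨Buckling.exists_isSpectrum hn hΩ.nonempty hb, fun _ hΛ => Buckling.spectrum_sum_le hn hb hΛ⟩
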